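/- Let $D$ be a plane diagram of an oriented link, let $\mathcal I$ be its set of double points, and let $x(D)$, $y(D)$ be the numbers of its negative and positive crossings. For a commutative ring $S$ and $c\in S$ let $A$ be the free $S$-module on $\mathbf 1,X$ (of degrees $1,-1$) with the multiplication $m$ for which $\mathbf 1$ is the unit and $X^2=0$, and the comultiplication $\Delta(\mathbf 1)=\mathbf 1\otimes X+X\otimes\mathbf 1+c\,X\otimes X$, $\Delta(X)=X\otimes X$. For $\mathcal L\subset\mathcal I$ let $D(\mathcal L)$ be the collection of circles obtained by the $1$-resolution of the points of $\mathcal L$ and the $0$-resolution of the others. (The orientation-preserving resolution is the $0$-resolution at a positive crossing and the $1$-resolution at a negative one.) The complex has in cohomological degree $i$ the module $\bigoplus_{|\mathcal L|=i+x(D)}A^{\otimes(\text{circles of }D(\mathcal L))}$, with degrees raised by $|\mathcal L|+y(D)-2x(D)$; its differential is the sum of the maps $m$ (two circles merge) and $\Delta$ (a circle splits) over all $\mathcal L\subset\mathcal L\cup\{a\}$, with the usual signs making the squares of the cube anticommute. For $S=\mathbb Z[c]$, $\deg c=2$, this is $C(D)$, with differential $d$; its part in cohomological degree $i$ and internal degree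 $j$ is $C^i_j(D)$, and $H^{i,j}(D)$ is the $i$-th cohomology group of $C^\bullet_j(D)$. For $S=\mathbb Z$, $c=0$, it is $\mathcal C(D)$, with differential $\partial$, graded parts $\mathcal C^i_j(D)$ and cohomology groups $\mathcal H^{i,j}(D)$. Then: 1. $d^2=0$ and $\partial^2=0$, and $d$ and $\partial$ raise $i$ by one and preserve $j$. Expansion in powers of $c$ gives $C^i_j(D)=\bigoplus_{k\ge0}c^k\,\mathcal C^i_{j-2k}(D)$ for all $i,j\in\mathbb Z$. 2. There is a map $\widetilde\partial$ on $\mathcal C(D)$, taking $\mathcal C^i_j(D)$ to $\mathcal C^{i+1}_{j-2}(D)$ for all $i,j$, such that under this identification $d=\partial+\widetilde\partial$, where $\partial$ maps the summand with index $k$ to the summand with index $k$, and $\widetilde\partial$ maps it to the summand with index $k+1$. Moreover $\widetilde\partial\widetilde\partial=0$ and $\partial\widetilde\partial+\widetilde\partial\partial=0$. 3. Fix $j\in\mathbb Z$, and let $F^pC^i_j(D)$ be the group of elements of $C^i_j(D)$ divisible by $c^p$ (everything if $p\le0$). There is a cohomological spectral sequence $(E_r^{p,q},d_r)_{r\ge1}$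 of abelian groups, with $d_r$ of bidegree $(r,1-r)$, which is the spectral sequence of this filtered complex: with $Z_r^{p,q}=\{u\in F^pC_j^{p+q}(D): du\in F^{p+r}C_j^{p+q+1}(D)\}$, $$E_r^{p,q}\cong Z_r^{p,q}/\bigl(Z_{r-1}^{p+1,q-1}+d\,Z_{r-1}^{p-r+1,q+r-2}\bigr),$$ $d_r$ is induced by $d$, and $H(E_r)\cong E_{r+1}$ is induced by the inclusions $Z_{r+1}^{p,q}\subset Z_r^{p,q}$. Its $E_1$-term is $$E_1^{k,q}\cong\mathcal H^{k+q,\,j-2k}(D)\quad(k\ge0),\qquad E_1^{p,q}=0\quad(p<0),$$ the isomorphism being given by the coefficient of $c^k$. 4. The spectral sequence converges to $H^{i,j}(D)$: let $F^pH^{i,j}(D)$ be the group of classes of cocycles lying in $F^pC^i_j(D)$. Then $F^pH^{i,j}(D)=H^{i,j}(D)$ for $p\le0$, and there is $N\ge1$ such that $F^pH^{i,j}(D)=0$ for all $i$ and all $p\ge N$, and such that for all $r\ge N$ and all $p,q$ one has $d_r=0$ and $$E_r^{p,q}\cong F^pH^{p+q,j}(D)/F^{p+1}H^{p+q,j}(D),$$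 where the class of a cocycle of $F^pC^{p+q}_j(D)$ corresponds to the class of its cohomology class. -/

import Mathlib

/-- A plane diagram of an oriented link, given combinatorially by its planar diagram code.

There are `n` double points.  The four ends of arcs at the double point `x` are
`(x, 0), (x, 1), (x, 2), (x, 3)`, listed counterclockwise, where `(x, 0)` is the incoming end of
the lower strand (so `(x, 2)` is the outgoing end of the lower strand, and the upper strand joins
`(x, 1)` and `(x, 3)`).  `opp` exchanges the two ends of every arc.  `positive x` says that the
upper strand runs from `(x, 3)` to `(x, 1)`, i.e. that `x` is a positive crossing.  The diagram has
`loops` further components that are simple closed curves without double points.  The last field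
says that the underlying 4-valent map is planar: vertices - edges + faces = 2 * components. -/
structure PlaneDiagram where
  n : ℕ
  opp : Fin n × Fin 4 → Fin n × Fin 4
  opp_opp : ∀ e, opp (opp e) = e
  opp_ne : ∀ e, opp e ≠ e
  positive : Fin n → Bool
  loops : ℕ
  /-- Arcs are oriented consistently: one end is outgoing at its double point, the other one is
  incoming. -/
  oriented : ∀ e : Fin n × Fin 4,
    (((opp e).2 = 2 ∨ (opp e).2 = if positive (opp e).1 then 1 else 3) ↔
      ¬ (e.2 = 2 ∨ e.2 = if positive e.1 then 1 else 3))
  planar :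
    n + Nat.card (Quot fun e f : Fin n × Fin 4 => f = ((opp e).1, (opp e).2 + 1)) =
      Nat.card (Quot fun e f : Fin n × Fin 4 => f = opp e) +
        2 * Nat.card (Quot fun e f : Fin n × Fin 4 => f = opp e ∨ f = (e.1, e.2 + 1))

/-- The two standard generators `1` and `X` of the free rank two module `A`. -/
inductive AGen
  | one
  | X

namespace AGen

instance : Finite AGen :=
  Finite.of_injective (fun g : AGen => match g with | one => true | X => false)
    (by intro a b h; cases a <;> cases b <;> simp_all)

/-- `deg 1 = 1`, `deg X = -1`. -/
def deg : AGen → ℤ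
  | one => 1
  | X => -1

/-- The coefficient of `g` in the product `m(a ⊗ b)`: `1` is the unit and `X² = 0`. -/
def mulCoeff (S : Type) [CommRing S] : AGen → AGen → AGen → S
  | one, one, one => 1
  | one, X, X => 1
  | X, one, X => 1
  | _, _, _ => 0

/-- The coefficient of `a ⊗ b` in `Δ(g)`:
`Δ(1) = 1 ⊗ X + X ⊗ 1 + c X ⊗ X` and `Δ(X) = X ⊗ X`. -/
def comulCoeff {S : Type} [CommRing S] (c : S) : AGen → AGen → AGen → S
  | one, one, X => 1
  | one, X, one => 1
  | one, X, X => c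
  | X, X, X => 1
  | _, _, _ => 0

end AGen

namespace PlaneDiagram

variable (D : PlaneDiagram)

/-- The number of negative crossings. -/
def x : ℕ := (Finset.univ.filter fun a => D.positive a = false).card

/-- The number of positive crossings. -/
def y : ℕ := (Finset.univ.filter fun a => D.positive a = true).card

/-- The end of an arc to which `e` is joined, at its double point, in the resolution `D(L)`: the
`0`-resolution joins `0` to `1` and `2` to `3`, the `1`-resolution joins `0` to `3` and
`1` to `2`. -/
def smooth (L : Finset (Fin D.n)) (e : Fin D.n × Fin 4) : Fin D.n × Fin 4 :=
  (e.1, if e.1 ∈ L then 3 - e.2 else ![1, 0, 3, 2] e.2)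

/-- The circles of the resolution `D(L)` that pass near double points. -/
abbrev Curve (L : Finset (Fin D.n)) : Type :=
  Quot fun e f : Fin D.n × Fin 4 => f = D.opp e ∨ f = D.smooth L e

/-- The set of all circles of the resolution `D(L)`. -/
abbrev Circle (L : Finset (Fin D.n)) : Type := D.Curve L ⊕ Fin D.loops

noncomputable instance (L : Finset (Fin D.n)) : Fintype (D.Circle L) := Fintype.ofFinite _

/-- The basis of `⨁_L A^{⊗ (circles of D(L))}` formed by the tensor products of generators: a
basis element is a set `L` of double points with a labelling of the circles of `D(L)` by
`1` and `X`. -/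
abbrev State : Type := Σ L : Finset (Fin D.n), (D.Circle L → AGen)

noncomputable instance : Fintype D.State := Fintype.ofFinite _

/-- The cohomological degree `|L| - x(D)` of a basis element of `C(D)`. -/
def hdeg (s : D.State) : ℤ := (s.1.card : ℤ) - D.x

/-- The internal degree of a basis element of `C(D)`: the degree in the tensor power of `A`, raised
by `|L|`, and raised by `y(D) - 2 x(D)`. -/
noncomputable def qdeg (s : D.State) : ℤ :=
  ∑ z, (s.2 z).deg + s.1.card + D.y - 2 * D.x

open Classical in
/-- The matrix entry, from the basis element `s` to the basis element `t`, of the structure map of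
the cube at `(L, a)`, where `s` lies over `L` and `t` lies over `L ∪ {a}`.  The labels of the
circles away from `a` have to agree; near `a` the map is `m` if two circles of `D(L)` meet at `a`,
and `Δ` if only one does. -/
noncomputable def edgeCoeff {S : Type} [CommRing S] (c : S) (a : Fin D.n) (s t : D.State) : S :=
  let P : D.Curve s.1 := Quot.mk _ (a, 0)
  let Q : D.Curve s.1 := Quot.mk _ (a, 2)
  let P' : D.Curve t.1 := Quot.mk _ (a, 0)
  let Q' : D.Curve t.1 := Quot.mk _ (a, 2)
  if (∀ e : Fin D.n × Fin 4, (Quot.mk _ e : D.Curve s.1) ≠ P → (Quot.mk _ e : D.Curve s.1) ≠ Q →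
        s.2 (.inl (Quot.mk _ e)) = t.2 (.inl (Quot.mk _ e))) ∧
      ∀ l : Fin D.loops, s.2 (.inr l) = t.2 (.inr l) then
    if P ≠ Q then AGen.mulCoeff S (s.2 (.inl P)) (s.2 (.inl Q)) (t.2 (.inl P'))
    else AGen.comulCoeff c (s.2 (.inl P)) (t.2 (.inl P')) (t.2 (.inl Q'))
  else 0

/-- The differential of `C(D)`, on the direct sum of all the modules of the complex, over the base
ring `S` with parameter `c`.  The sign `(-1)^{#{b ∈ L | a < b}}` is the structure map
`E(L) → E(L ∪ {a})`, `x ↦ xa`, of the skew cube `E`, written in the generators given by the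
increasing orderings; the sign `(-1)^{x(D)}` comes from the shift `[x(D)]`. -/
noncomputable def diff {S : Type} [CommRing S] (c : S) : (D.State → S) →ₗ[S] (D.State → S) :=
  Matrix.mulVecLin <| Matrix.of fun t s =>
    (-1) ^ D.x * ∑ a with a ∉ s.1 ∧ t.1 = insert a s.1,
      (-1) ^ (s.1.filter (a < ·)).card * D.edgeCoeff c a s t

/-- The differential `d` of `C(D)`, over `ℤ[c]`. -/
noncomputable def d : (D.State → Polynomial ℤ) →+ (D.State → Polynomial ℤ) :=
  (D.diff (Polynomial.X : Polynomial ℤ)).toAddMonoidHom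

/-- The differential `∂` of `𝒞(D)`, over `ℤ`, with `c = 0`. -/
noncomputable def del : (D.State → ℤ) →+ (D.State → ℤ) :=
  (D.diff (0 : ℤ)).toAddMonoidHom

/-- `C^i_j(D)`, where `c` has degree `2`. -/
def C (i j : ℤ) : AddSubgroup (D.State → Polynomial ℤ) where
  carrier := {f | ∀ s k, (f s).coeff k ≠ 0 → D.hdeg s = i ∧ D.qdeg s + 2 * (k : ℤ) = j}
  zero_mem' := by intro s k h; simp at h
  add_mem' := by
    intro f g hf hg s k h
    by_cases h1 : (f s).coeff k = 0
    · exact hg s k fun h2 => h (by simp [h1, h2])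
    · exact hf s k h1
  neg_mem' := by
    intro f hf s k h
    exact hf s k fun h1 => h (by simp [h1])

/-- `𝒞^i_j(D)`. -/
def C0 (i j : ℤ) : AddSubgroup (D.State → ℤ) where
  carrier := {f | ∀ s, f s ≠ 0 → D.hdeg s = i ∧ D.qdeg s = j}
  zero_mem' := by intro s h; simp at h
  add_mem' := by
    intro f g hf hg s h
    by_cases h1 : f s = 0
    · exact hg s fun h2 => h (by simp [h1, h2])
    · exact hf s h1
  neg_mem' := by
    intro f hf s h
    exact hf s fun h1 => h (by simp [h1])

/-- The filtration of `C^i_j(D)` by powers of `c`: `F^p` consists of the elements divisible by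
`c^p`, and is everything for `p ≤ 0`. -/
def F (j p i : ℤ) : AddSubgroup (D.State → Polynomial ℤ) where
  carrier := {f | f ∈ D.C i j ∧ ∀ s, (Polynomial.X : Polynomial ℤ) ^ p.toNat ∣ f s}
  zero_mem' := ⟨zero_mem _, fun _ => dvd_zero _⟩
  add_mem' := fun hf hg => ⟨add_mem hf.1 hg.1, fun s => dvd_add (hf.2 s) (hg.2 s)⟩
  neg_mem' := fun hf => ⟨neg_mem hf.1, fun s => (dvd_neg).2 (hf.2 s)⟩

/-- The coefficient of `c^k`. -/
def cCoeff (k : ℕ) : (D.State → Polynomial ℤ) →+ (D.State → ℤ) where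
  toFun f s := (f s).coeff k
  map_zero' := by ext; simp
  map_add' f g := by ext; simp

end PlaneDiagram

/-! ### Cohomology and filtered complexes

A complex is given by an abelian group `M`, an endomorphism `d` of `M` with `d ∘ d = 0` and
subgroups `K i` (the group in degree `i`) with `d (K i) ⊆ K (i + 1)`. -/

section FilteredComplex

variable {M : Type} [AddCommGroup M] (d : M →+ M)

/-- The cocycles in degree `i`. -/
def cocycles (K : ℤ → AddSubgroup M) (i : ℤ) : AddSubgroup M := K i ⊓ d.ker

/-- The `i`-th cohomology group: cocycles modulo coboundaries. -/
abbrev Cohomology (K : ℤ → AddSubgroup M) (i : ℤ) : Type :=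
  cocycles d K i ⧸ ((K (i - 1)).map d).addSubgroupOf (cocycles d K i)

/-- The subgroup of the `i`-th cohomology group formed by the classes of cocycles in
`F^p`, for a filtration `F p i` of the groups `K i`. -/
def filtCohomology (K : ℤ → AddSubgroup M) (F : ℤ → ℤ → AddSubgroup M) (p i : ℤ) :
    AddSubgroup (Cohomology d K i) :=
  ((F p i).addSubgroupOf (cocycles d K i)).map (QuotientAddGroup.mk' _)

/-- `Z_r^p` in degree `i`: the elements of `F^p` whose differential lies in `F^{p+r}`. -/
def filtZ (F : ℤ → ℤ → AddSubgroup M) (r p i : ℤ) : AddSubgroup M :=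
  F p i ⊓ (F (p + r) (i + 1)).comap d

/-- `Z_{r-1}^{p+1} + d Z_{r-1}^{p-r+1}` in degree `i`. -/
def filtB (F : ℤ → ℤ → AddSubgroup M) (r p i : ℤ) : AddSubgroup M :=
  filtZ d F (r - 1) (p + 1) i ⊔ (filtZ d F (r - 1) (p - r + 1) (i - 1)).map d

open CategoryTheory in
/-- `E` is the spectral sequence of the complex with the decreasing filtration `F`, from the page
`E_1` on.  The maps `π` identify `E_r^{p,q}` with
`Z_r^p / (Z_{r-1}^{p+1} + d Z_{r-1}^{p-r+1})` in degree `p + q`; under this identification `d_r` is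
induced by `d`, and the isomorphism `H(E_r) ≅ E_{r+1}` is induced by the inclusion
`Z_{r+1}^p ⊆ Z_r^p`. -/
structure IsFiltrationSpectralSequence (F : ℤ → ℤ → AddSubgroup M)
    (E : CohomologicalSpectralSequence AddCommGrpCat.{0} 1)
    (π : ∀ (r : ℤ) (hr : 1 ≤ r) (p q : ℤ), filtZ d F r p (p + q) →+ (E.page r hr).X (p, q)) :
    Prop where
  surjective : ∀ r hr p q, Function.Surjective (π r hr p q)
  eq_zero_iff : ∀ r hr p q u, π r hr p q u = 0 ↔ (u : M) ∈ filtB d F r p (p + q)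
  map_d : ∀ (r : ℤ) (hr : 1 ≤ r) (p q : ℤ) (u : filtZ d F r p (p + q)),
    ∃ h : d u ∈ filtZ d F r (p + r) ((p + r) + (q + (1 - r))),
      (E.page r hr).d (p, q) (p + r, q + (1 - r)) (π r hr p q u) =
        π r hr (p + r) (q + (1 - r)) ⟨d u, h⟩
  map_iso : ∀ (r : ℤ) (hr : 1 ≤ r) (p q : ℤ) (u : filtZ d F (r + 1) p (p + q)),
    ∃ (h : (u : M) ∈ filtZ d F r p (p + q)) (z : (E.page r hr).cycles (p, q)),
      (E.page r hr).iCycles (p, q) z = π r hr p q ⟨u, h⟩ ∧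
      (E.iso r (r + 1) (p, q) rfl hr).hom ((E.page r hr).homologyπ (p, q) z) =
        π (r + 1) (by lia) p q u

end FilteredComplex

namespace PlaneDiagram

variable (D : PlaneDiagram)

/-- `H^{i,j}(D)`, the cohomology over `ℤ[c]`. -/
abbrev H (i j : ℤ) : Type := Cohomology D.d (fun i => D.C i j) i

/-- `ℋ^{i,j}(D)`, the cohomology over `ℤ`, with `c = 0`. -/
abbrev H0 (i j : ℤ) : Type := Cohomology D.del (fun i => D.C0 i j) i

end PlaneDiagram

/-! ### The spectral sequence of a filtered complex, from explicit cycles and boundaries. -/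

section SpectralSequence

open CategoryTheory

/-! The geometric content is $d^2=0$; the rest is algebra of polynomials in $c$. Each edge of the
cube is a surgery on circles, and $A^{\otimes Z}$ is generated by its unit under the commuting
operators `labelX z`. Merging and splitting both commute with multiplication by $X$ at every point
of the diagram (`IsSurgery.surgeryMap_labelX`), so a structure map is determined by the image of the
unit: the unit for a merge, $\Delta(\mathbf 1)$ for a split. The two ways around a square are
therefore products of factors $\Delta(\mathbf 1)$, and counting circles shows that these products
agree (`surgeryMap_comp_comm`). The signs then make the squares anticommute.

Planarity is needed to know that changing one resolution always merges two circles or splits one,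
and never turns one circle into one circle. Euler's formula, read as a rank count over $\mathbb
F_2$, yields a checkerboard colouring of the faces, hence an orientation of the arcs that alternates
around every double point. Both resolutions respect it, so circles become cycles of a permutation,
and changing one resolution exchanges two values of that permutation;
`Equiv.Perm.sameCycle_exchange_iff` says what this does to the cycles.

The matrix entries of $d$ have degree at most one in $c$ and are homogeneous for $\deg c=2$. Thus
$d=\partial+c\,\widetilde\partial$, and the coefficients of $d^2=0$ are the relations between
$\partial$ and $\widetilde\partial$. The $k$-th graded piece of the filtration by powers of $c$ is
$\mathcal C_{j-2k}(D)$ with differential $\partial$, which gives $E_1$. For fixed $j$ the filtration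
is finite, since a term $c^k s$ needs `qdeg s + 2k = j` and there are finitely many $s$; hence the
pages stabilise at the graded pieces of $H^{i,j}(D)$.

The isomorphisms $H(E_r)\cong E_{r+1}$, those for $E_1$ and those for the limit all arise by mapping
one group of representatives onto both sides with the same kernel. -/

/-- Both targets are the quotient of `A` by the same kernel. The formula on representatives is kept
because every identification in the theorem is specified by one. -/
theorem exists_addEquiv_of_surjective {A B C : Type*} [AddCommGroup A] [AddCommGroup B]
    [AddCommGroup C] (f : A →+ B) (g : A →+ C) (hf : Function.Surjective f)
    (hg : Function.Surjective g) (h : ∀ a, f a = 0 ↔ g a = 0) :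
    ∃ e : B ≃+ C, ∀ a, e (f a) = g a := by
  have hk : f.ker = g.ker := by
    ext a
    exact h a
  refine ⟨(QuotientAddGroup.quotientKerEquivOfSurjective f hf).symm.trans
    ((QuotientAddGroup.quotientAddEquivOfEq hk).trans
      (QuotientAddGroup.quotientKerEquivOfSurjective g hg)), fun a => ?_⟩
  have : (QuotientAddGroup.quotientKerEquivOfSurjective f hf).symm (f a) =
      QuotientAddGroup.mk a := by
    rw [AddEquiv.symm_apply_eq]
    rfl
  simp only [AddEquiv.trans_apply, this]
  rfl

/-- Passage from categorical homology to elements, through the concrete model of kernel modulo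
range. -/
theorem CategoryTheory.ShortComplex.ab_homologyπ_eq_zero_iff (S : ShortComplex Ab.{0})
    (x : AddMonoidHom.ker S.g.hom) :
    S.homologyπ (S.abCyclesIso.inv x) = 0 ↔ ∃ y, S.f y = (x : S.X₂) := by
  have h1 : S.abHomologyIso.hom (S.homologyπ (S.abCyclesIso.inv x)) =
      QuotientAddGroup.mk (s := AddMonoidHom.range S.abToCycles) x := by
    have h2 : S.abCyclesIso.inv ≫ S.homologyπ ≫ S.abHomologyIso.hom =
        S.abLeftHomologyData.π :=
      (Iso.inv_comp_eq _).2 S.abLeftHomologyData.homologyπ_comp_homologyIso_hom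
    have h3 := congrArg (fun f => f.hom x) h2
    exact h3
  have h4 : S.homologyπ (S.abCyclesIso.inv x) = 0 ↔
      S.abHomologyIso.hom (S.homologyπ (S.abCyclesIso.inv x)) = 0 := by
    constructor
    · intro h
      rw [h, map_zero]
    · intro h
      have := congrArg S.abHomologyIso.inv h
      rw [map_zero] at this
      rw [← this]
      simp
  rw [h4, h1]
  erw [QuotientAddGroup.eq_zero_iff]
  constructor
  · rintro ⟨y, hy⟩
    exact ⟨y, congrArg Subtype.val hy⟩
  · rintro ⟨y, hy⟩
    exact ⟨y, Subtype.ext hy⟩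

section FilteredPages

variable {M : Type} [AddCommGroup M] (d : M →+ M) (F : ℤ → ℤ → AddSubgroup M)

/-- A complex with a decreasing filtration by subcomplexes. -/
structure IsFilteredComplex : Prop where
  d_d : ∀ x, d (d x) = 0
  anti : ∀ {p p' i : ℤ}, p ≤ p' → F p' i ≤ F p i
  map_d : ∀ {p i : ℤ} {x : M}, x ∈ F p i → d x ∈ F p (i + 1)

/-- The term `E_r^{p,q}` of the spectral sequence of a filtered complex. -/
abbrev FiltPageX (r p q : ℤ) : Type :=
  filtZ d F r p (p + q) ⧸ (filtB d F r p (p + q)).addSubgroupOf (filtZ d F r p (p + q))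

variable {d F}

theorem mem_filtZ {r p i : ℤ} {u : M} :
    u ∈ filtZ d F r p i ↔ u ∈ F p i ∧ d u ∈ F (p + r) (i + 1) := Iff.rfl

theorem mem_filtB {r p i : ℤ} {u : M} :
    u ∈ filtB d F r p i ↔ ∃ v ∈ filtZ d F (r - 1) (p + 1) i,
      ∃ w ∈ filtZ d F (r - 1) (p - r + 1) (i - 1), v + d w = u := by
  simp only [filtB, AddSubgroup.mem_sup, AddSubgroup.mem_map, exists_exists_and_eq_and]

theorem FiltPageX.mk_eq_zero_iff {r p q : ℤ} (u : filtZ d F r p (p + q)) :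
    (QuotientAddGroup.mk u : FiltPageX d F r p q) = 0 ↔ (u : M) ∈ filtB d F r p (p + q) := by
  rw [QuotientAddGroup.eq_zero_iff, AddSubgroup.mem_addSubgroupOf]

namespace IsFilteredComplex

variable (h : IsFilteredComplex d F)

include h

theorem d_mem_filtZ {r p i p' i' : ℤ} (hp : p + r = p') (hi : i + 1 = i') {u : M}
    (hu : u ∈ filtZ d F r p i) : d u ∈ filtZ d F r p' i' := by
  subst hp hi
  refine mem_filtZ.2 ⟨hu.2, ?_⟩
  rw [h.d_d]
  exact zero_mem _

theorem d_mem_filtB {r p i p' i' : ℤ} (hp : p + r = p') (hi : i + 1 = i') {u : M}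
    (hu : u ∈ filtB d F r p i) : d u ∈ filtB d F r p' i' := by
  obtain ⟨v, hv, w, hw, rfl⟩ := mem_filtB.1 hu
  refine mem_filtB.2 ⟨0, zero_mem _, v, ?_, ?_⟩
  · rwa [show p' - r + 1 = p + 1 by lia, show i' - 1 = i by lia]
  · rw [map_add, h.d_d, zero_add, add_zero]

theorem filtZ_succ_le {r p i : ℤ} : filtZ d F (r + 1) p i ≤ filtZ d F r p i :=
  fun _ hu => ⟨hu.1, h.anti (by lia) hu.2⟩

/-- This is the kernel of $Z_{r+1}^p\to H(E_r)$. An element of $Z_{r-1}^{p-r+1}$ also lies in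
$Z_r^{p-r}$, so it can be absorbed into `w`; the remaining $v\in F^{p+1}$ satisfies $dv=du\in
F^{p+r+1}$ because $d^2=0$, hence $v\in Z_r^{p+1}$. -/
theorem mem_filtB_succ_iff {r p i : ℤ} {u : M} (hu : u ∈ filtZ d F (r + 1) p i) :
    u ∈ filtB d F (r + 1) p i ↔
      ∃ w ∈ filtZ d F r (p - r) (i - 1), u - d w ∈ filtB d F r p i := by
  constructor
  · intro hB
    obtain ⟨v, hv, w, hw, rfl⟩ := mem_filtB.1 hB
    rw [add_sub_cancel_right] at hv hw
    refine ⟨w, by rwa [show p - r = p - (r + 1) + 1 by lia], mem_filtB.2 ⟨v, ?_, 0, zero_mem _, ?_⟩⟩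
    · exact h.filtZ_succ_le (by rwa [sub_add_cancel])
    · rw [map_zero, add_sub_cancel_right, add_zero]
  · rintro ⟨w, hw, hB⟩
    obtain ⟨v, hv, w', hw', e⟩ := mem_filtB.1 hB
    have hw2 : w + w' ∈ filtZ d F r (p - r) (i - 1) := by
      refine add_mem hw (mem_filtZ.2 ⟨h.anti (by lia) hw'.1, ?_⟩)
      have := (mem_filtZ.1 hw').2
      rwa [show p - r + r = p - r + 1 + (r - 1) by lia]
    have e2 : v + d (w + w') = u := by
      rw [map_add, add_comm (d w), ← add_assoc, e, sub_add_cancel]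
    refine mem_filtB.2 ⟨v, mem_filtZ.2 ⟨hv.1, ?_⟩, w + w', ?_, e2⟩
    · have : d v = d u := by rw [← e2, map_add, h.d_d, add_zero]
      have hu2 := (mem_filtZ.1 hu).2
      rwa [this, show p + 1 + (r + 1 - 1) = p + (r + 1) by lia]
    · rwa [add_sub_cancel_right, show p - (r + 1) + 1 = p - r by lia]

/-- Surjectivity of $Z_{r+1}^p\to H(E_r)$: if $du=v+dw$ with $v\in F^{p+r+1}$ and $w\in
Z_{r-1}^{p+1}$, then $u-w$ represents the same class of $E_r$ and its differential is $v$. -/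
theorem exists_sub_mem_filtB {r p i : ℤ} {u : M} (hu : u ∈ filtZ d F r p i)
    (hd : d u ∈ filtB d F r (p + r) (i + 1)) :
    ∃ v ∈ filtZ d F (r + 1) p i, u - v ∈ filtB d F r p i := by
  obtain ⟨v, hv, w, hw, e⟩ := mem_filtB.1 hd
  rw [add_sub_cancel_right, add_sub_cancel_right] at hw
  refine ⟨u - w, mem_filtZ.2 ⟨(F p i).sub_mem hu.1 (h.anti (by lia) hw.1), ?_⟩,
    mem_filtB.2 ⟨w, hw, 0, zero_mem _, by rw [map_zero, add_zero, sub_sub_cancel]⟩⟩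
  rw [map_sub, ← e, add_sub_cancel_right, ← add_assoc]
  exact hv.1

/-- The differential of the `r`-th page of the spectral sequence of a filtered complex. -/
def pageD {r p q p' q' : ℤ} (hp : p + r = p') (hq : q + (1 - r) = q') :
    FiltPageX d F r p q →+ FiltPageX d F r p' q' :=
  QuotientAddGroup.map _ _
    ((d.comp (filtZ d F r p (p + q)).subtype).codRestrict (filtZ d F r p' (p' + q'))
      fun u => h.d_mem_filtZ hp (by lia) u.2)
    fun _ hu => h.d_mem_filtB hp (by lia) hu

theorem pageD_mk {r p q p' q' : ℤ} (hp : p + r = p') (hq : q + (1 - r) = q')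
    (u : filtZ d F r p (p + q)) :
    h.pageD hp hq (QuotientAddGroup.mk u) =
      QuotientAddGroup.mk ⟨d u, h.d_mem_filtZ hp (by lia) u.2⟩ := rfl

open Classical in
/-- The `r`-th page of the spectral sequence of a filtered complex. -/
noncomputable def page (r : ℤ) :
    HomologicalComplex AddCommGrpCat.{0} (ComplexShape.up' ((r, 1 - r) : ℤ × ℤ)) where
  X pq := AddCommGrpCat.of (FiltPageX d F r pq.1 pq.2)
  d pq pq' :=
    if e : pq + (r, 1 - r) = pq' then
      AddCommGrpCat.ofHom (h.pageD (congrArg Prod.fst e) (congrArg Prod.snd e))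
    else 0
  shape pq pq' e := dif_neg e
  d_comp_d' pq pq' pq'' e e' := by
    have e₁ : pq + (r, 1 - r) = pq' := e
    have e₂ : pq' + (r, 1 - r) = pq'' := e'
    rw [dif_pos e₁, dif_pos e₂, ← AddCommGrpCat.ofHom_comp]
    refine AddCommGrpCat.hom_ext (QuotientAddGroup.addMonoidHom_ext _ (AddMonoidHom.ext fun u => ?_))
    change h.pageD (congrArg Prod.fst e₂) (congrArg Prod.snd e₂)
      (h.pageD (congrArg Prod.fst e₁) (congrArg Prod.snd e₁) (QuotientAddGroup.mk u)) = 0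
    rw [pageD_mk, pageD_mk, FiltPageX.mk_eq_zero_iff]
    simp only [h.d_d]
    exact zero_mem _

/-- The class in `E_r^{p,q}` of an element of `Z_r^{p,q}`. -/
noncomputable def pageMk (r : ℤ) (pq : ℤ × ℤ) :
    filtZ d F r pq.1 (pq.1 + pq.2) →+ (h.page r).X pq :=
  QuotientAddGroup.mk' ((filtB d F r pq.1 (pq.1 + pq.2)).addSubgroupOf
    (filtZ d F r pq.1 (pq.1 + pq.2)))

theorem pageMk_surjective (r : ℤ) (pq : ℤ × ℤ) : Function.Surjective (h.pageMk r pq) :=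
  QuotientAddGroup.mk'_surjective _

theorem pageMk_eq_zero_iff {r : ℤ} {pq : ℤ × ℤ} (u : filtZ d F r pq.1 (pq.1 + pq.2)) :
    h.pageMk r pq u = 0 ↔ (u : M) ∈ filtB d F r pq.1 (pq.1 + pq.2) :=
  FiltPageX.mk_eq_zero_iff (q := pq.2) u

theorem page_d_pageMk {r : ℤ} {pq pq' : ℤ × ℤ} (e : pq + (r, 1 - r) = pq')
    (u : filtZ d F r pq.1 (pq.1 + pq.2)) :
    ∃ hu : d u ∈ filtZ d F r pq'.1 (pq'.1 + pq'.2),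
      (h.page r).d pq pq' (h.pageMk r pq u) = h.pageMk r pq' ⟨d u, hu⟩ := by
  have h1 : pq.1 + r = pq'.1 := congrArg Prod.fst e
  have h2 : pq.2 + (1 - r) = pq'.2 := congrArg Prod.snd e
  refine ⟨h.d_mem_filtZ h1 (by lia) u.2, ?_⟩
  have : (h.page r).d pq pq' = AddCommGrpCat.ofHom (h.pageD h1 h2) := dif_pos e
  rw [this]
  rfl

theorem exists_homology_iso (r : ℤ) (pq : ℤ × ℤ) :
    ∃ e : (h.page r).homology pq ≅ (h.page (r + 1)).X pq,
      ∀ u : filtZ d F (r + 1) pq.1 (pq.1 + pq.2),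
        ∃ z : (h.page r).cycles pq,
          (h.page r).iCycles pq z = h.pageMk r pq ⟨u, h.filtZ_succ_le u.2⟩ ∧
          e.hom ((h.page r).homologyπ pq z) = h.pageMk (r + 1) pq u := by
  let S := (h.page r).sc pq
  -- The neighbours of `pq` in the complex shape are replaced by indices known only through their
  -- equations, so that the maps of the short complex can be compared with the explicit
  -- differentials of the page.
  obtain ⟨nx, hnx⟩ : ∃ nx, nx = (ComplexShape.up' ((r, 1 - r) : ℤ × ℤ)).next pq := ⟨_, rfl⟩
  have hn : pq + (r, 1 - r) = nx :=
    hnx.trans ((ComplexShape.up' ((r, 1 - r) : ℤ × ℤ)).next_eq' rfl) |>.symm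
  obtain ⟨pv, hpv⟩ : ∃ pv, pv = (ComplexShape.up' ((r, 1 - r) : ℤ × ℤ)).prev pq := ⟨_, rfl⟩
  have hp : pv + (r, 1 - r) = pq := by
    rw [hpv, (ComplexShape.up' ((r, 1 - r) : ℤ × ℤ)).prev_eq'
      (show (ComplexShape.up' ((r, 1 - r) : ℤ × ℤ)).Rel (pq - (r, 1 - r)) pq from
        sub_add_cancel pq (r, 1 - r)), sub_add_cancel]
  have hg : ∀ x, S.g x = 0 ↔ (h.page r).d pq nx x = 0 := by
    subst hnx
    exact fun _ => Iff.rfl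
  have hf : ∀ x, (∃ y, S.f y = x) ↔ ∃ y, (h.page r).d pv pq y = x := by
    subst hpv
    exact fun _ => Iff.rfl
  have hn1 : pq.1 + r = nx.1 := congrArg Prod.fst hn
  have hn2 : pq.2 + (1 - r) = nx.2 := congrArg Prod.snd hn
  have hp1 : pv.1 + r = pq.1 := congrArg Prod.fst hp
  have hp2 : pv.2 + (1 - r) = pq.2 := congrArg Prod.snd hp
  have hg' : ∀ u, S.g (h.pageMk r pq u) = 0 ↔ d u ∈ filtB d F r (pq.1 + r) (pq.1 + pq.2 + 1) := by
    intro u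
    obtain ⟨hu, e⟩ := h.page_d_pageMk hn u
    refine (hg _).trans ?_
    rw [e, pageMk_eq_zero_iff, hn1, show pq.1 + pq.2 + 1 = nx.1 + nx.2 by lia]
  let ι : filtZ d F (r + 1) pq.1 (pq.1 + pq.2) →+ AddMonoidHom.ker S.g.hom :=
    AddMonoidHom.codRestrict (M := filtZ d F (r + 1) pq.1 (pq.1 + pq.2)) (N := S.X₂)
      ((h.pageMk r pq).comp (AddSubgroup.inclusion h.filtZ_succ_le)) _ <| fun u => by
        refine (hg' _).2 (mem_filtB.2 ⟨d u, ?_, 0, zero_mem _, by simp⟩)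
        refine mem_filtZ.2 ⟨?_, ?_⟩
        · rw [add_assoc]
          exact (mem_filtZ.1 u.2).2
        · rw [h.d_d]
          exact zero_mem _
  let α : filtZ d F (r + 1) pq.1 (pq.1 + pq.2) →+ (h.page r).homology pq :=
    (S.abCyclesIso.inv ≫ S.homologyπ).hom.comp ι
  have hα : Function.Surjective α := by
    intro b
    obtain ⟨z, rfl⟩ := (AddCommGrpCat.epi_iff_surjective S.homologyπ).1 inferInstance b
    obtain ⟨⟨x, hx⟩, rfl⟩ : ∃ x, S.abCyclesIso.inv x = z := ⟨S.abCyclesIso.hom z, by simp⟩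
    obtain ⟨u, rfl⟩ := h.pageMk_surjective r pq x
    obtain ⟨v, hv, hB⟩ := h.exists_sub_mem_filtB u.2 ((hg' u).1 hx)
    refine ⟨⟨v, hv⟩, congrArg (fun x => S.homologyπ (S.abCyclesIso.inv x)) (Subtype.ext ?_)⟩
    refine (sub_eq_zero.1 ?_).symm
    refine ((h.pageMk r pq).map_sub u ⟨v, h.filtZ_succ_le hv⟩).symm.trans ?_
    exact (h.pageMk_eq_zero_iff _).2 hB
  obtain ⟨e, he⟩ := exists_addEquiv_of_surjective α (h.pageMk (r + 1) pq) hα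
    (h.pageMk_surjective _ _) (by
      intro u
      refine (S.ab_homologyπ_eq_zero_iff (ι u)).trans ?_
      rw [pageMk_eq_zero_iff, h.mem_filtB_succ_iff u.2, hf]
      have key : ∀ w : filtZ d F r pv.1 (pv.1 + pv.2),
          (h.page r).d pv pq (h.pageMk r pv w) =
              h.pageMk r pq ⟨u, h.filtZ_succ_le u.2⟩ ↔
            (u : M) - d w ∈ filtB d F r pq.1 (pq.1 + pq.2) := by
        intro w
        obtain ⟨hw, e⟩ := h.page_d_pageMk hp w
        rw [e, eq_comm]
        refine Iff.trans ?_ (h.pageMk_eq_zero_iff (⟨u, h.filtZ_succ_le u.2⟩ - ⟨d w, hw⟩))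
        rw [map_sub, sub_eq_zero]
      change (∃ y, (h.page r).d pv pq y = h.pageMk r pq ⟨u, h.filtZ_succ_le u.2⟩) ↔ _
      rw [(h.pageMk_surjective r pv).exists]
      simp only [key, Subtype.exists, exists_prop]
      rw [show pq.1 - r = pv.1 by lia, show pq.1 + pq.2 - 1 = pv.1 + pv.2 by lia])
  exact ⟨e.toAddCommGrpIso, fun u => ⟨S.abCyclesIso.inv (ι u),
    S.abCyclesIso_inv_apply_iCycles (ι u), he u⟩⟩

/-- The spectral sequence of a filtered complex. -/
noncomputable def spectralSequence : CohomologicalSpectralSequence AddCommGrpCat.{0} 1 where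
  page r _ := h.page r
  iso r r' pq hr _ := by
    subst hr
    exact (h.exists_homology_iso r pq).choose

theorem isFiltrationSpectralSequence :
    IsFiltrationSpectralSequence d F h.spectralSequence fun r _ p q => h.pageMk r (p, q) where
  surjective r _ p q := h.pageMk_surjective r (p, q)
  eq_zero_iff r _ p q u := h.pageMk_eq_zero_iff (pq := (p, q)) u
  map_d r _ p q u := h.page_d_pageMk (pq := (p, q)) rfl u
  map_iso r _ p q u := by
    obtain ⟨z, hz⟩ := (h.exists_homology_iso r (p, q)).choose_spec u
    exact ⟨_, z, hz⟩

end IsFilteredComplex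

end FilteredPages

end SpectralSequence

/-! ### Convergence for a filtration that is everything for $p\le 0$ and zero for $p\ge N$. -/

section ConvergenceOfPages

open CategoryTheory

section Convergence

variable {M : Type} [AddCommGroup M] {d : M →+ M} {F : ℤ → ℤ → AddSubgroup M}
  {K : ℤ → AddSubgroup M}

theorem mem_cocycles {i : ℤ} {u : M} : u ∈ cocycles d K i ↔ u ∈ K i ∧ d u = 0 := Iff.rfl

theorem Cohomology.mk_eq_zero_iff {i : ℤ} (v : cocycles d K i) :
    (QuotientAddGroup.mk v : Cohomology d K i) = 0 ↔ ∃ w ∈ K (i - 1), d w = v := by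
  rw [QuotientAddGroup.eq_zero_iff, AddSubgroup.mem_addSubgroupOf, AddSubgroup.mem_map]

theorem mem_filtCohomology {p i : ℤ} {x : Cohomology d K i} :
    x ∈ filtCohomology d K F p i ↔
      ∃ v : cocycles d K i, (v : M) ∈ F p i ∧ QuotientAddGroup.mk v = x := Iff.rfl

theorem mk_mem_filtCohomology_iff {p i : ℤ} (v : cocycles d K i) :
    (QuotientAddGroup.mk v : Cohomology d K i) ∈ filtCohomology d K F p i ↔
      ∃ u ∈ cocycles d K i, u ∈ F p i ∧ ∃ w ∈ K (i - 1), u + d w = v := by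
  rw [mem_filtCohomology]
  constructor
  · rintro ⟨u, hu, e⟩
    rw [eq_comm, ← sub_eq_zero, ← QuotientAddGroup.mk_sub, Cohomology.mk_eq_zero_iff] at e
    obtain ⟨w, hw, e⟩ := e
    refine ⟨u, u.2, hu, w, hw, ?_⟩
    rw [e, AddSubgroup.coe_sub, add_sub_cancel]
  · rintro ⟨u, hu, hF, w, hw, e⟩
    refine ⟨⟨u, hu⟩, hF, Eq.symm ?_⟩
    rw [← sub_eq_zero, ← QuotientAddGroup.mk_sub, Cohomology.mk_eq_zero_iff]
    refine ⟨w, hw, ?_⟩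
    rw [AddSubgroup.coe_sub, ← e, add_sub_cancel_left]

theorem filtCohomology_eq_top (hK : ∀ {p i : ℤ}, p ≤ 0 → F p i = K i) {p i : ℤ} (hp : p ≤ 0) :
    filtCohomology d K F p i = ⊤ := by
  refine eq_top_iff.2 fun x _ => ?_
  obtain ⟨v, rfl⟩ := QuotientAddGroup.mk_surjective x
  refine mem_filtCohomology.2 ⟨v, ?_, rfl⟩
  rw [hK hp]
  exact (mem_cocycles.1 v.2).1

theorem filtCohomology_eq_bot {p i : ℤ} (hF : F p i = ⊥) :
    filtCohomology d K F p i = ⊥ := by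
  refine eq_bot_iff.2 fun x hx => ?_
  obtain ⟨v, hv, rfl⟩ := mem_filtCohomology.1 hx
  rw [hF, AddSubgroup.mem_bot] at hv
  rw [AddSubgroup.mem_bot, Cohomology.mk_eq_zero_iff]
  exact ⟨0, zero_mem _, by rw [map_zero, hv]⟩

/-- For $p<0$ the groups $F^p$ and $F^{p+1}$ coincide, so $Z_r^p$ is contained in $Z_{r-1}^{p+1}$.
-/
theorem mem_filtB_of_neg (hK : ∀ {p i : ℤ}, p ≤ 0 → F p i = K i) {r p i : ℤ} (hp : p < 0)
    {u : M} (hu : u ∈ filtZ d F r p i) : u ∈ filtB d F r p i := by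
  refine mem_filtB.2 ⟨u, mem_filtZ.2 ⟨?_, ?_⟩, 0, zero_mem _, by simp⟩
  · rw [hK (show p + 1 ≤ 0 by lia), ← hK hp.le]
    exact hu.1
  · rw [add_add_sub_cancel]
    exact hu.2

namespace IsFilteredComplex

variable (h : IsFilteredComplex d F)

include h

theorem subsingleton_page_of_neg (hK : ∀ {p i : ℤ}, p ≤ 0 → F p i = K i) {r p : ℤ} (q : ℤ)
    (hp : p < 0) : Subsingleton ((h.page r).X (p, q)) := by
  refine subsingleton_of_forall_eq 0 fun x => ?_
  obtain ⟨u, rfl⟩ := h.pageMk_surjective r (p, q) x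
  have hu : (u : M) ∈ filtZ d F r p (p + q) := u.2
  have hB : (u : M) ∈ filtB d F r p (p + q) := mem_filtB_of_neg (K := K) (fun e => hK e) hp hu
  rw [pageMk_eq_zero_iff]
  exact hB

theorem subsingleton_page_of_eq_bot {r p q : ℤ} (hF : F p (p + q) = ⊥) :
    Subsingleton ((h.page r).X (p, q)) := by
  refine subsingleton_of_forall_eq 0 fun x => ?_
  obtain ⟨u, rfl⟩ := h.pageMk_surjective r (p, q) x
  have : (u : M) = 0 := by
    have := (mem_filtZ.1 u.2).1
    rwa [hF, AddSubgroup.mem_bot] at this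
  rw [pageMk_eq_zero_iff, this]
  exact zero_mem _

/-- The source vanishes if $p<0$; otherwise $p+r\ge N$ and the target vanishes. -/
theorem page_d_eq_zero (hK : ∀ {p i : ℤ}, p ≤ 0 → F p i = K i) {N : ℤ}
    (hN : ∀ {p i : ℤ}, N ≤ p → F p i = ⊥) {r : ℤ} (hr : N ≤ r) (pq pq' : ℤ × ℤ) :
    (h.page r).d pq pq' = 0 := by
  by_cases e : pq + (r, 1 - r) = pq'
  · have h1 : pq.1 + r = pq'.1 := congrArg Prod.fst e
    refine AddCommGrpCat.hom_ext (AddMonoidHom.ext fun x => ?_)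
    rcases lt_or_ge pq.1 0 with hp | hp
    · have := h.subsingleton_page_of_neg hK (r := r) pq.2 hp
      rw [Subsingleton.elim (α := (h.page r).X (pq.1, pq.2)) x 0]
      exact (map_zero _).trans (map_zero _).symm
    · have := h.subsingleton_page_of_eq_bot (r := r) (p := pq'.1) (q := pq'.2) (hN (by lia))
      exact Subsingleton.elim (α := (h.page r).X (pq'.1, pq'.2)) _ _
  · exact (h.page r).shape _ _ e

/-- The common group of representatives is that of cocycles in $F^p$. It maps onto $E_r^{p,q}$
because, for $p\ge 0$ and $r\ge N$, an element of $Z_r^p$ has differential in $F^{p+r}=0$. -/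
theorem exists_page_equiv_filtCohomology (hK : ∀ {p i : ℤ}, p ≤ 0 → F p i = K i) {N : ℤ}
    (hN : ∀ {p i : ℤ}, N ≤ p → F p i = ⊥) {r : ℤ} (hr : N ≤ r) (p q : ℤ) :
    ∃ ψ : (h.page r).X (p, q) ≃+ filtCohomology d K F p (p + q) ⧸
        (filtCohomology d K F (p + 1) (p + q)).addSubgroupOf (filtCohomology d K F p (p + q)),
      ∀ (v : cocycles d K (p + q)) (hv : (v : M) ∈ F p (p + q)),
        ∃ hZ : (v : M) ∈ filtZ d F r p (p + q),
          ψ (h.pageMk r (p, q) ⟨v, hZ⟩) =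
            QuotientAddGroup.mk ⟨QuotientAddGroup.mk v, ⟨v, hv, rfl⟩⟩ := by
  have hFK : ∀ {p i : ℤ}, F p i ≤ K i := fun {p i} => by
    rw [← hK (le_refl 0)]
    rcases le_or_gt 0 p with hp | hp
    · exact h.anti hp
    · rw [hK hp.le, hK le_rfl]
  have hZ : ∀ {v : M}, v ∈ cocycles d K (p + q) → v ∈ F p (p + q) → v ∈ filtZ d F r p (p + q) :=
    fun hv hF => mem_filtZ.2 ⟨hF, by rw [(mem_cocycles.1 hv).2]; exact zero_mem _⟩
  let A := (F p (p + q)).addSubgroupOf (cocycles d K (p + q))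
  let α : A →+ (h.page r).X (p, q) := (h.pageMk r (p, q)).comp
    (((cocycles d K (p + q)).subtype.comp A.subtype).codRestrict _ fun v => hZ v.1.2 v.2)
  let β : A →+ filtCohomology d K F p (p + q) ⧸
      (filtCohomology d K F (p + 1) (p + q)).addSubgroupOf (filtCohomology d K F p (p + q)) :=
    (QuotientAddGroup.mk' _).comp
      (((QuotientAddGroup.mk' _).comp A.subtype).codRestrict (filtCohomology d K F p (p + q))
        fun v => ⟨v, v.2, rfl⟩)
  have hα : Function.Surjective α := by
    intro x
    rcases lt_or_ge p 0 with hp | hp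
    · have := h.subsingleton_page_of_neg hK (r := r) q hp
      exact ⟨0, Subsingleton.elim _ _⟩
    · obtain ⟨u, rfl⟩ := h.pageMk_surjective r (p, q) x
      have hu := mem_filtZ.1 u.2
      have h2 := hu.2
      rw [hN (by simp only; lia), AddSubgroup.mem_bot] at h2
      exact ⟨⟨⟨u, mem_cocycles.2 ⟨hFK hu.1, h2⟩⟩, hu.1⟩, rfl⟩
  have hβ : Function.Surjective β := by
    intro x
    obtain ⟨⟨_, v, hv, rfl⟩, rfl⟩ := QuotientAddGroup.mk_surjective x
    exact ⟨⟨v, hv⟩, rfl⟩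
  have hαβ : ∀ v, α v = 0 ↔ β v = 0 := by
    intro v
    refine (h.pageMk_eq_zero_iff (pq := (p, q)) _).trans (Iff.symm ?_)
    refine (QuotientAddGroup.eq_zero_iff
      (N := (filtCohomology d K F (p + 1) (p + q)).addSubgroupOf (filtCohomology d K F p (p + q)))
      ⟨QuotientAddGroup.mk v.1, v, v.2, rfl⟩).trans ?_
    refine (mk_mem_filtCohomology_iff (p := p + 1) v.1).trans ?_
    constructor
    · rintro ⟨u, hu, hF, w, hw, e⟩
      -- If $p-r+1\le 0$, then $F^{p-r+1}$ is everything and imposes no condition on `w`; otherwise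
      -- $p\ge r\ge N$, so the cocycle itself is zero.
      rcases lt_or_ge (p - r + 1) 1 with hp | hp
      · refine mem_filtB.2 ⟨u, mem_filtZ.2 ⟨hF, ?_⟩, w, mem_filtZ.2 ⟨?_, ?_⟩, e⟩
        · rw [(mem_cocycles.1 hu).2]
          exact zero_mem _
        · rwa [hK (by lia)]
        · have e1 : d w = v - u := by rw [← e, add_sub_cancel_left]
          rw [e1, show p - r + 1 + (r - 1) = p by lia, sub_add_cancel]
          exact sub_mem v.2 (h.anti (by lia) hF)
      · have hv : (v.1 : M) = 0 := by
          have := v.2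
          rwa [AddSubgroup.mem_addSubgroupOf, hN (by lia), AddSubgroup.mem_bot] at this
        change (v.1 : M) ∈ _
        rw [hv]
        exact zero_mem _
    · intro hB
      obtain ⟨u, hu, w, hw, e⟩ := mem_filtB.1 hB
      refine ⟨u, mem_cocycles.2 ⟨hFK hu.1, ?_⟩, hu.1, w, hFK hw.1, e⟩
      have := congrArg d e
      rw [map_add, h.d_d, add_zero] at this
      exact this.trans (mem_cocycles.1 v.1.2).2
  obtain ⟨e, he⟩ := exists_addEquiv_of_surjective (C := filtCohomology d K F p (p + q) ⧸
    (filtCohomology d K F (p + 1) (p + q)).addSubgroupOf (filtCohomology d K F p (p + q)))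
    α β hα hβ hαβ
  exact ⟨e, fun v hv => ⟨hZ v.2 hv, he ⟨v, hv⟩⟩⟩

end IsFilteredComplex

end Convergence

end ConvergenceOfPages

/-! ### Rank counts over $\mathbb F_2$ for incidence matrices. -/

section Incidence

open Matrix

variable {X A B C : Type*} [Fintype X] [Fintype B] [Fintype C]

open Classical in
/-- The incidence matrix over `𝔽₂` of the images of the elements of `X` in `A` and `B`. -/
noncomputable def incidence (p : X → A) (q : X → B) : Matrix A B (ZMod 2) :=
  Matrix.of fun a b => ∑ x, if p x = a ∧ q x = b then 1 else 0

open Classical in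
omit [Fintype B] in
theorem incidence_transpose (p : X → A) (q : X → B) : (incidence p q)ᵀ = incidence q p := by
  ext a b
  simp only [incidence, transpose_apply, of_apply]
  exact Finset.sum_congr rfl fun x _ => if_congr and_comm rfl rfl

open Classical in
theorem incidence_mulVec (p : X → A) (q : X → B) (κ : B → ZMod 2) (a : A) :
    (incidence p q *ᵥ κ) a = ∑ x, if p x = a then κ (q x) else 0 := by
  simp only [incidence, mulVec, dotProduct, of_apply, Finset.sum_mul]
  rw [Finset.sum_comm]
  refine Finset.sum_congr rfl fun x _ => ?_
  by_cases h : p x = a <;> simp [h]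

/-- The kernel consists of functions pulled back along `π`, so its dimension is at most the size of
`C`; apply rank-nullity. -/
theorem card_le_rank_add_card (N : Matrix A B (ZMod 2)) (π : B → C)
    (h : ∀ κ, N *ᵥ κ = 0 → ∃ γ : C → ZMod 2, ∀ b, κ b = γ (π b)) :
    Fintype.card B ≤ N.rank + Fintype.card C := by
  have h1 : LinearMap.ker N.mulVecLin ≤ LinearMap.range (LinearMap.funLeft (ZMod 2) (ZMod 2) π) := by
    intro κ hκ
    obtain ⟨γ, hγ⟩ := h κ hκ
    exact ⟨γ, (funext hγ).symm⟩
  have h2 := Submodule.finrank_mono h1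
  have h3 := LinearMap.finrank_range_le (LinearMap.funLeft (ZMod 2) (ZMod 2) π)
  have h4 := LinearMap.finrank_range_add_finrank_ker N.mulVecLin
  rw [Module.finrank_fintype_fun_eq_card] at h3 h4
  rw [Matrix.rank]
  lia

/-- The range of `N` lies in the kernel of `Mᵀ`, and the rank hypothesis leaves no room for a
difference. -/
theorem exists_mulVec_eq_of_rank [Fintype A] {M : Matrix A B (ZMod 2)} {N : Matrix A C (ZMod 2)}
    (hMN : ∀ κ, Mᵀ *ᵥ (N *ᵥ κ) = 0) (hr : Fintype.card A ≤ M.rank + N.rank) {g : A → ZMod 2}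
    (hg : Mᵀ *ᵥ g = 0) : ∃ κ, N *ᵥ κ = g := by
  classical
  have h1 : LinearMap.range N.mulVecLin ≤ LinearMap.ker Mᵀ.mulVecLin := by
    rintro _ ⟨κ, rfl⟩
    exact hMN κ
  have h2 := LinearMap.finrank_range_add_finrank_ker Mᵀ.mulVecLin
  rw [Module.finrank_fintype_fun_eq_card] at h2
  have h3 : Module.finrank (ZMod 2) (LinearMap.range Mᵀ.mulVecLin) = M.rank := M.rank_transpose
  have h4 : Module.finrank (ZMod 2) (LinearMap.range N.mulVecLin) = N.rank := rfl
  have h5 := Submodule.eq_of_le_of_finrank_le h1 (by lia)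
  have h6 : g ∈ LinearMap.ker Mᵀ.mulVecLin := hg
  rw [← h5] at h6
  exact h6

end Incidence

theorem ZMod.two_eq_of_add_eq_zero {a b : ZMod 2} (h : a + b = 0) : a = b := by
  revert a b
  decide

theorem ZMod.two_eq_add_one_of_add_eq_one {a b : ZMod 2} (h : a + b = 1) : b = a + 1 := by
  revert a b
  decide

/-! ### Checkerboard colouring of a plane diagram. -/

namespace PlaneDiagram

open Matrix

variable (D : PlaneDiagram)

/-- The arcs between double points. -/
abbrev Edge : Type := Quot fun e f : Fin D.n × Fin 4 => f = D.opp e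

/-- The faces of the components of the underlying 4-valent map. -/
abbrev Face : Type := Quot fun e f : Fin D.n × Fin 4 => f = ((D.opp e).1, (D.opp e).2 + 1)

/-- The connected components of the underlying 4-valent map. -/
abbrev Component : Type := Quot fun e f : Fin D.n × Fin 4 => f = D.opp e ∨ f = (e.1, e.2 + 1)

noncomputable instance : Fintype D.Edge := Fintype.ofFinite _

noncomputable instance : Fintype D.Face := Fintype.ofFinite _

noncomputable instance : Fintype D.Component := Fintype.ofFinite _

/-- The arc that ends at `e`. -/
def edge (e : Fin D.n × Fin 4) : D.Edge := Quot.mk _ e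

/-- The face on the side of `e`. -/
def face (e : Fin D.n × Fin 4) : D.Face := Quot.mk _ e

/-- The connected component of `e`. -/
def component (e : Fin D.n × Fin 4) : D.Component := Quot.mk _ e

theorem edge_opp (e : Fin D.n × Fin 4) : D.edge (D.opp e) = D.edge e :=
  (Quot.sound (r := fun e f : Fin D.n × Fin 4 => f = D.opp e) rfl).symm

theorem face_rot (e : Fin D.n × Fin 4) : D.face (e.1, e.2 + 1) = D.face (D.opp e) :=
  (Quot.sound (by rw [D.opp_opp])).symm

theorem edge_eq_iff {e f : Fin D.n × Fin 4} : D.edge e = D.edge f ↔ e = f ∨ e = D.opp f := by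
  constructor
  · intro h
    let s : D.Edge → Set (Fin D.n × Fin 4) := Quot.lift (fun e => {e, D.opp e}) (by
      rintro a _ rfl
      rw [D.opp_opp, Set.pair_comm])
    have hs : s (D.edge e) = s (D.edge f) := congrArg s h
    have he : e ∈ s (D.edge e) := Or.inl rfl
    rw [hs] at he
    exact he
  · rintro (rfl | rfl)
    · rfl
    · exact D.edge_opp f

open Classical in
theorem sum_edge_eq (e : Fin D.n × Fin 4) (f : Fin D.n × Fin 4 → ZMod 2) :
    ∑ x, (if D.edge x = D.edge e then f x else 0) = f e + f (D.opp e) := by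
  have : (Finset.univ.filter fun x => D.edge x = D.edge e) = {e, D.opp e} := by
    ext x
    simp [D.edge_eq_iff]
  rw [← Finset.sum_filter, this, Finset.sum_pair (D.opp_ne e).symm]

theorem incidence_edge_mulVec {B : Type*} [Fintype B] (q : Fin D.n × Fin 4 → B) (κ : B → ZMod 2)
    (e : Fin D.n × Fin 4) :
    (incidence D.edge q *ᵥ κ) (D.edge e) = κ (q e) + κ (q (D.opp e)) := by
  classical
  rw [incidence_mulVec, D.sum_edge_eq e fun x => κ (q x)]

theorem incidence_fst_mulVec {B : Type*} [Fintype B] (q : Fin D.n × Fin 4 → B) (g : B → ZMod 2)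
    (v : Fin D.n) :
    (incidence (Prod.fst : Fin D.n × Fin 4 → Fin D.n) q *ᵥ g) v = ∑ i, g (q (v, i)) := by
  classical
  rw [incidence_mulVec, Fintype.sum_prod_type, Finset.sum_eq_single v] <;> simp_all

theorem sum_fin_four_add_rot (f : Fin 4 → ZMod 2) : ∑ i, (f i + f (i + 1)) = 0 := by
  rw [Finset.sum_add_distrib,
    show ∑ i, f (i + 1) = ∑ i, f i from Equiv.sum_comp (Equiv.addRight (1 : Fin 4)) f]
  exact CharTwo.add_self_eq_zero _

/-- Exactness of the sequence faces → edges → vertices over $\mathbb F_2$, that is, vanishing of the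
first homology of the sphere. On each connected component, a function on vertices or faces with zero
coboundary is constant; this bounds the two ranks from below, and `planar` makes the bounds sum to
the number of edges. The constant function 1 on edges is a cycle since every vertex has four ends,
so it is a sum of face boundaries: adjacent faces get different colours. -/
theorem exists_face_colouring :
    ∃ κ : D.Face → ZMod 2, ∀ e, κ (D.face e) + κ (D.face (D.opp e)) = 1 := by
  have h1 : Fintype.card (Fin D.n) ≤
      (incidence D.edge Prod.fst).rank + Fintype.card D.Component := by
    refine card_le_rank_add_card _ (fun v => D.component (v, 0)) fun h hh => ?_
    have h2 : ∀ e, h e.1 = h (D.opp e).1 := fun e => by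
      have := congrFun hh (D.edge e)
      rw [D.incidence_edge_mulVec] at this
      exact ZMod.two_eq_of_add_eq_zero this
    refine ⟨Quot.lift (fun e => h e.1) ?_, fun v => rfl⟩
    rintro e _ (rfl | rfl)
    · exact h2 e
    · rfl
  have h2 : Fintype.card D.Face ≤
      (incidence D.edge D.face).rank + Fintype.card D.Component := by
    refine card_le_rank_add_card _ (fun v => D.component v.out) fun κ hκ => ?_
    have h2 : ∀ e, κ (D.face e) = κ (D.face (D.opp e)) := fun e => by
      have := congrFun hκ (D.edge e)
      rw [D.incidence_edge_mulVec] at this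
      exact ZMod.two_eq_of_add_eq_zero this
    refine ⟨Quot.lift (fun e => κ (D.face e)) ?_, fun v => ?_⟩
    · rintro e _ (rfl | rfl)
      · exact h2 e
      · rw [D.face_rot]
        exact h2 e
    · exact congrArg κ v.out_eq.symm
  have h3 := D.planar
  rw [Nat.card_eq_fintype_card (α := D.Face), Nat.card_eq_fintype_card (α := D.Edge),
    Nat.card_eq_fintype_card (α := D.Component)] at h3
  rw [Fintype.card_fin] at h1
  obtain ⟨κ, hκ⟩ := exists_mulVec_eq_of_rank (M := incidence D.edge Prod.fst)
    (N := incidence D.edge D.face) (g := fun _ => 1) (fun κ => by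
      ext v
      rw [incidence_transpose, incidence_fst_mulVec]
      simp only [incidence_edge_mulVec, ← D.face_rot]
      exact sum_fin_four_add_rot fun i => κ (D.face (v, i))) (by lia) (by
      ext v
      rw [incidence_transpose, incidence_fst_mulVec]
      rfl)
  exact ⟨κ, fun e => by rw [← D.incidence_edge_mulVec, hκ]⟩

/-- The arcs of a plane diagram can be oriented so that incoming and outgoing ends alternate at
each double point. -/
theorem exists_alternating_orientation :
    ∃ σ : Fin D.n × Fin 4 → ZMod 2,
      (∀ e, σ (D.opp e) = σ e + 1) ∧ ∀ a i, σ (a, i + 1) = σ (a, i) + 1 := by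
  obtain ⟨κ, hκ⟩ := D.exists_face_colouring
  have h : ∀ e, κ (D.face (D.opp e)) = κ (D.face e) + 1 := fun e =>
    ZMod.two_eq_add_one_of_add_eq_one (hκ e)
  exact ⟨fun e => κ (D.face e), h, fun a i => by rw [← h, ← D.face_rot]⟩

end PlaneDiagram

/-! ### Exchanging two values of a permutation. -/

section Dynamics

variable {X : Type*} [Finite X] {g g' : Equiv.Perm X} {x y : X} {s : Set X}

-- After its first step from `x`, the orbit under `g'` follows the orbit of `y` under `g` until the
-- latter first meets `x` or `y`.
omit [Finite X] in
theorem Equiv.Perm.iterate_eq_of_exchange (hx : g' x = g y)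
    (hs : ∀ z ∈ s, z ≠ x → z ≠ y → g' z = g z) (hg : ∀ k, g^[k] y ∈ s) {n : ℕ}
    (hn : ∀ k, 0 < k → k < n → g^[k] y ≠ x ∧ g^[k] y ≠ y) :
    ∀ k, 0 < k → k ≤ n → g'^[k] x = g^[k] y := by
  intro k hk
  induction k, hk using Nat.le_induction with
  | base => exact fun _ => hx
  | succ k hk ih =>
    intro hkn
    rw [Function.iterate_succ_apply', Function.iterate_succ_apply', ih (by lia)]
    exact hs _ (hg k) (hn k hk hkn).1 (hn k hk hkn).2

/-- If two permutations agree on an invariant set except that the images of `x` and `y` are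
exchanged, then `x` and `y` lie on a common cycle of exactly one of them. -/
theorem Equiv.Perm.sameCycle_exchange_iff (hxy : x ≠ y) (hx : g' x = g y)
    (hs : ∀ z ∈ s, z ≠ x → z ≠ y → g' z = g z) (hgs : ∀ z ∈ s, g z ∈ s) (hys : y ∈ s) :
    g'.SameCycle x y ↔ ¬ g.SameCycle x y := by
  classical
  have hg : ∀ k, g^[k] y ∈ s := fun k => by
    induction k with
    | zero => exact hys
    | succ k ih =>
      rw [Function.iterate_succ_apply']
      exact hgs _ ih
  -- Consider the first time `n` at which the `g`-orbit of `y` meets `x` or `y`. If it meets `x`,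
  -- the `g'`-orbit of `x` closes up after `n` steps and misses `y`. If it returns to `y`, the
  -- `g`-cycle of `y` misses `x`, while `g'` carries `x` to `y` in `n` steps.
  have hex : ∃ n, 0 < n ∧ (g^[n] y = x ∨ g^[n] y = y) := by
    refine ⟨orderOf g, orderOf_pos g, Or.inr ?_⟩
    rw [Equiv.Perm.iterate_eq_pow, pow_orderOf_eq_one, Equiv.Perm.one_apply]
  obtain ⟨hn0, hn⟩ := Nat.find_spec hex
  have hmin : ∀ k, 0 < k → k < Nat.find hex → g^[k] y ≠ x ∧ g^[k] y ≠ y := by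
    intro k h0 hk
    have := Nat.find_min hex hk
    tauto
  generalize Nat.find hex = n at *
  have hit := Equiv.Perm.iterate_eq_of_exchange hx hs hg hmin
  rcases hn with hn | hn
  · have hsame : g.SameCycle x y := by
      refine Equiv.Perm.SameCycle.symm ⟨n, ?_⟩
      rw [zpow_natCast, ← Equiv.Perm.iterate_eq_pow, hn]
    refine iff_of_false (fun h => ?_) (not_not.2 hsame)
    obtain ⟨m, hm⟩ := h.exists_nat_pow_eq
    have hper : Function.IsPeriodicPt g' n x := (hit n hn0 le_rfl).trans hn
    rw [← Equiv.Perm.iterate_eq_pow, ← hper.iterate_mod_apply] at hm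
    rcases Nat.eq_zero_or_pos (m % n) with h0 | h0
    · rw [h0] at hm
      exact hxy hm
    · have hlt := Nat.mod_lt m hn0
      rw [hit _ h0 hlt.le] at hm
      exact (hmin _ h0 hlt).2 hm
  · refine iff_of_true ⟨n, ?_⟩ fun h => ?_
    · rw [zpow_natCast, ← Equiv.Perm.iterate_eq_pow, hit n hn0 le_rfl, hn]
    · obtain ⟨m, hm⟩ := h.symm.exists_nat_pow_eq
      have hper : Function.IsPeriodicPt g n y := hn
      rw [← Equiv.Perm.iterate_eq_pow, ← hper.iterate_mod_apply] at hm
      rcases Nat.eq_zero_or_pos (m % n) with h0 | h0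
      · rw [h0] at hm
        exact hxy hm.symm
      · exact (hmin _ h0 (Nat.mod_lt m hn0)).1 hm

end Dynamics

/-- The circles `Z₁` and `Z₂`, parametrized by `c₁` and `c₂`, differ by a surgery near `x` and
`y`, which merges two circles or splits one. -/
structure IsSurgery {J Z₁ Z₂ : Type*} (c₁ : J → Z₁) (c₂ : J → Z₂) (x y : J) : Prop where
  near_iff : ∀ j, (c₁ j = c₁ x ∨ c₁ j = c₁ y) ↔ (c₂ j = c₂ x ∨ c₂ j = c₂ y)
  eq_iff : ∀ j k, ¬ (c₁ j = c₁ x ∨ c₁ j = c₁ y) → (c₁ j = c₁ k ↔ c₂ j = c₂ k)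
  ne_iff : c₁ x ≠ c₁ y ↔ c₂ x = c₂ y

theorem IsSurgery.symm {J Z₁ Z₂ : Type*} {c₁ : J → Z₁} {c₂ : J → Z₂} {x y : J}
    (h : IsSurgery c₁ c₂ x y) : IsSurgery c₂ c₁ x y where
  near_iff j := (h.near_iff j).symm
  eq_iff j k hj := (h.eq_iff j k fun e => hj ((h.near_iff j).1 e)).symm
  ne_iff := by rw [Ne, ← h.ne_iff, not_not]

/-! ### Circles of a resolution, and the surgery at a double point. -/

namespace PlaneDiagram

variable (D : PlaneDiagram)

/-- The circle of `D(L)` through the end of an arc or given by a component without double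
points. -/
def circle (L : Finset (Fin D.n)) : (Fin D.n × Fin 4) ⊕ Fin D.loops → D.Circle L :=
  Sum.map (Quot.mk _) id

theorem circle_surjective (L : Finset (Fin D.n)) : Function.Surjective (D.circle L) := by
  rintro (⟨⟨e⟩⟩ | l)
  · exact ⟨.inl e, rfl⟩
  · exact ⟨.inr l, rfl⟩

variable {D}

theorem circle_opp (L : Finset (Fin D.n)) (e : Fin D.n × Fin 4) :
    D.circle L (.inl (D.opp e)) = D.circle L (.inl e) :=
  congrArg Sum.inl (Quot.sound (r := fun e f => f = D.opp e ∨ f = D.smooth L e) (Or.inl rfl)).symm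

theorem circle_smooth (L : Finset (Fin D.n)) (e : Fin D.n × Fin 4) :
    D.circle L (.inl (D.smooth L e)) = D.circle L (.inl e) :=
  congrArg Sum.inl (Quot.sound (r := fun e f => f = D.opp e ∨ f = D.smooth L e) (Or.inr rfl)).symm

/-- Induction on the equality of circles. -/
theorem circle_induction {L : Finset (Fin D.n)} {R : Fin D.n × Fin 4 → Fin D.n × Fin 4 → Prop}
    (hR : Equivalence R) (ho : ∀ e, R e (D.opp e)) (hs : ∀ e, R e (D.smooth L e))
    {e f : Fin D.n × Fin 4} (h : D.circle L (.inl e) = D.circle L (.inl f)) : R e f := by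
  have h1 := Quot.eqvGen_exact (Sum.inl_injective h)
  refine (hR.eqvGen_iff).1 (h1.mono ?_)
  rintro a _ (rfl | rfl)
  · exact ho a
  · exact hs a

theorem smooth_smooth (L : Finset (Fin D.n)) (e : Fin D.n × Fin 4) :
    D.smooth L (D.smooth L e) = e := by
  obtain ⟨a, i⟩ := e
  by_cases h : a ∈ L
  · simp [smooth, h]
  · simp only [smooth, h, if_false, Prod.mk.injEq, true_and]
    fin_cases i <;> rfl

theorem circle_near (L : Finset (Fin D.n)) (a : Fin D.n) (i : Fin 4) :
    D.circle L (.inl (a, i)) = D.circle L (.inl (a, 0)) ∨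
      D.circle L (.inl (a, i)) = D.circle L (.inl (a, 2)) := by
  have h0 := circle_smooth L (a, 0)
  have h2 := circle_smooth L (a, 2)
  by_cases h : a ∈ L
  · simp only [smooth, h, if_true] at h0 h2
    fin_cases i
    · exact Or.inl rfl
    · exact Or.inr h2
    · exact Or.inr rfl
    · exact Or.inl h0
  · simp only [smooth, h, if_false] at h0 h2
    fin_cases i
    · exact Or.inl rfl
    · exact Or.inl h0
    · exact Or.inr rfl
    · exact Or.inr h2

variable (D) in
/-- The motion along the circles of `D(L)`. -/
def motion (L : Finset (Fin D.n)) : Equiv.Perm (Fin D.n × Fin 4) where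
  toFun e := D.opp (D.smooth L e)
  invFun e := D.smooth L (D.opp e)
  left_inv e := by simp only [D.opp_opp, smooth_smooth]
  right_inv e := by simp only [D.opp_opp, smooth_smooth]

theorem motion_apply (L : Finset (Fin D.n)) (e : Fin D.n × Fin 4) :
    D.motion L e = D.opp (D.smooth L e) := rfl

section Alternating

variable {σ : Fin D.n × Fin 4 → ZMod 2} (ho : ∀ e, σ (D.opp e) = σ e + 1)
  (hr : ∀ a i, σ (a, i + 1) = σ (a, i) + 1)

include hr

/-- Both resolutions join cyclically neighbouring ends, and neighbouring ends have opposite `σ`. -/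
theorem alternating_smooth (L : Finset (Fin D.n)) (e : Fin D.n × Fin 4) :
    σ (D.smooth L e) = σ e + 1 := by
  obtain ⟨a, i⟩ := e
  have h0 : σ (a, 1) = σ (a, 0) + 1 := hr a 0
  have h1 : σ (a, 2) = σ (a, 1) + 1 := hr a 1
  have h2 : σ (a, 3) = σ (a, 2) + 1 := hr a 2
  have h3 : σ (a, 0) = σ (a, 3) + 1 := hr a 3
  have hz : ∀ z : ZMod 2, z = z + 1 + 1 := by decide
  by_cases h : a ∈ L
  · simp only [smooth, h, if_true]
    fin_cases i
    · change σ (a, 3) = σ (a, 0) + 1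
      rw [h3, ← hz]
    · exact h1
    · change σ (a, 1) = σ (a, 2) + 1
      rw [h1, ← hz]
    · exact h3
  · simp only [smooth, h, if_false]
    fin_cases i
    · exact h0
    · change σ (a, 0) = σ (a, 1) + 1
      rw [h0, ← hz]
    · exact h2
    · change σ (a, 2) = σ (a, 3) + 1
      rw [h2, ← hz]

include ho

/-- Crossing a joint and then an arc preserves `σ`, so on ends with `σ = 0` the motion traverses
each circle in one consistent direction and cannot reach it backwards. -/
theorem circle_eq_iff_sameCycle (L : Finset (Fin D.n)) {e f : Fin D.n × Fin 4} (he : σ e = 0)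
    (hf : σ f = 0) :
    D.circle L (.inl e) = D.circle L (.inl f) ↔ (D.motion L).SameCycle e f := by
  classical
  constructor
  · intro h
    -- Each arc has exactly one end with `σ = 0`; every end is replaced by that end of its arc.
    let pos : Fin D.n × Fin 4 → Fin D.n × Fin 4 := fun e => if σ e = 0 then e else D.opp e
    have hz : ∀ z : ZMod 2, ¬ z = 0 → z = 1 := by decide
    have key : (D.motion L).SameCycle (pos e) (pos f) := by
      refine circle_induction (R := fun e f => (D.motion L).SameCycle (pos e) (pos f))
        ⟨fun _ => .refl _ _, fun h => h.symm, fun h h' => h.trans h'⟩ (fun e => ?_) (fun e => ?_) h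
      · suffices pos (D.opp e) = pos e by
          rw [this]
        by_cases h0 : σ e = 0
        · simp [pos, ho, h0, D.opp_opp]
        · have h1 : (1 : ZMod 2) + 1 = 0 := by decide
          simp [pos, ho, hz _ h0, h1]
      · by_cases h0 : σ e = 0
        · have h1 : pos (D.smooth L e) = D.motion L e := by
            simp [pos, alternating_smooth hr, h0, motion_apply]
          have h2 : pos e = e := if_pos h0
          rw [h1, h2, Equiv.Perm.sameCycle_apply_right]
        · have h1 : pos (D.smooth L e) = D.smooth L e := by
            have h1 : (1 : ZMod 2) + 1 = 0 := by decide
            simp [pos, alternating_smooth hr, hz _ h0, h1]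
          have h2 : pos e = D.motion L (D.smooth L e) := by
            rw [motion_apply, smooth_smooth]
            exact if_neg h0
          rw [h1, h2, Equiv.Perm.sameCycle_apply_left]
    simpa only [pos, he, hf, if_true] using key
  · intro h
    obtain ⟨m, rfl⟩ := h.exists_nat_pow_eq
    rw [← Equiv.Perm.iterate_eq_pow]
    clear h hf
    induction m with
    | zero => rfl
    | succ m ih => rw [Function.iterate_succ_apply', motion_apply, circle_opp, circle_smooth, ← ih]

end Alternating

/-- Changing the resolution of one double point merges two circles or splits one. -/
theorem circle_insert_eq_iff {L : Finset (Fin D.n)} {a : Fin D.n} (ha : a ∉ L) :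
    D.circle (insert a L) (.inl (a, 0)) = D.circle (insert a L) (.inl (a, 2)) ↔
      D.circle L (.inl (a, 0)) ≠ D.circle L (.inl (a, 2)) := by
  obtain ⟨σ, ho, hr⟩ : ∃ σ : Fin D.n × Fin 4 → ZMod 2, (∀ e, σ (D.opp e) = σ e + 1) ∧
      (∀ a i, σ (a, i + 1) = σ (a, i) + 1) ∧ σ (a, 0) = 0 := by
    obtain ⟨σ, ho, hr⟩ := D.exists_alternating_orientation
    refine ⟨fun e => σ e - σ (a, 0), fun e => ?_, fun b i => ?_, sub_self _⟩
    · simp only [ho, add_sub_right_comm]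
    · simp only [hr, add_sub_right_comm]
  obtain ⟨hr, h0⟩ := hr
  have h1 : σ (a, 1) = σ (a, 0) + 1 := hr a 0
  have h2 : σ (a, 2) = σ (a, 1) + 1 := hr a 1
  have h3 : σ (a, 3) = σ (a, 2) + 1 := hr a 2
  have h2' : σ (a, 2) = 0 := by
    rw [h2, h1, h0]
    decide
  rw [Ne, circle_eq_iff_sameCycle ho hr _ h0 h2', circle_eq_iff_sameCycle ho hr _ h0 h2']
  -- On ends with `σ = 0` the two motions differ only at $(a,0)$ and $(a,2)$. The new joint sends
  -- $(a,0)$ to $(a,3)$, as the old one did $(a,2)$; the other two ends at `a` have `σ = 1`.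
  refine Equiv.Perm.sameCycle_exchange_iff (s := {e | σ e = 0}) (by simp) ?_ ?_ ?_ h2'
  · simp only [motion_apply, smooth, ha, Finset.mem_insert_self, if_true, if_false]
    rfl
  · rintro ⟨b, i⟩ hb hb0 hb2
    rw [motion_apply, motion_apply]
    congr 1
    by_cases hba : b = a
    · subst hba
      exfalso
      have h10 : ¬ (0 + 1 : ZMod 2) = 0 := by decide
      rw [Set.mem_ofPred_eq] at hb
      fin_cases i
      · exact hb0 rfl
      · exact h10 (by rw [← h0, ← h1, h0]; exact hb)
      · exact hb2 rfl
      · exact h10 (by rw [← h2', ← h3, h2']; exact hb)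
    · simp [smooth, hba]
  · intro e he
    rw [Set.mem_ofPred_eq] at he ⊢
    rw [motion_apply, ho, alternating_smooth hr, he]
    decide

/-- Stated symmetrically in the two resolutions at `a`, so that a split is a merge read backwards.
Away from `a` the joints agree; hence circles of `L` map to those of `L'`, and the only new
coincidences are between circles through `a`. -/
theorem isSurgery_of_eq {L L' : Finset (Fin D.n)} {a : Fin D.n}
    (hL : ∀ b, b ≠ a → (b ∈ L ↔ b ∈ L'))
    (h : D.circle L (.inl (a, 0)) ≠ D.circle L (.inl (a, 2)))
    (h' : D.circle L' (.inl (a, 0)) = D.circle L' (.inl (a, 2))) :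
    IsSurgery (D.circle L) (D.circle L') (.inl (a, 0)) (.inl (a, 2)) := by
  have hsm : ∀ e : Fin D.n × Fin 4, e.1 ≠ a → D.smooth L e = D.smooth L' e := fun e he => by
    simp only [smooth, hL e.1 he]
  have hne : ∀ L (e : Fin D.n × Fin 4), e.1 = a →
      (D.circle L (.inl e) = D.circle L (.inl (a, 0)) ∨
        D.circle L (.inl e) = D.circle L (.inl (a, 2))) := by
    rintro L ⟨_, i⟩ rfl
    exact circle_near L _ i
  have hcoarse : ∀ j k, D.circle L j = D.circle L k → D.circle L' j = D.circle L' k := by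
    rintro (e | l) (f | l') hjk
    · refine circle_induction (R := fun e f => D.circle L' (.inl e) = D.circle L' (.inl f))
        ⟨fun _ => rfl, fun h => h.symm, fun h h' => h.trans h'⟩
        (fun e => (circle_opp L' e).symm) (fun e => ?_) hjk
      by_cases he : e.1 = a
      · have h1 := hne L' e he
        have h2 := hne L' (D.smooth L e) he
        rw [h', or_self] at h1 h2
        rw [h1, h2]
      · rw [hsm e he, circle_smooth]
    · cases hjk
    · cases hjk
    · rw [show l = l' from Sum.inr_injective hjk]
  have hfine : ∀ j k, D.circle L' j = D.circle L' k → D.circle L j = D.circle L k ∨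
      ((D.circle L j = D.circle L (.inl (a, 0)) ∨ D.circle L j = D.circle L (.inl (a, 2))) ∧
      (D.circle L k = D.circle L (.inl (a, 0)) ∨ D.circle L k = D.circle L (.inl (a, 2)))) := by
    rintro (e | l) (f | l') hjk
    · refine circle_induction (R := fun e f => D.circle L (.inl e) = D.circle L (.inl f) ∨
        ((D.circle L (.inl e) = D.circle L (.inl (a, 0)) ∨
          D.circle L (.inl e) = D.circle L (.inl (a, 2))) ∧
        (D.circle L (.inl f) = D.circle L (.inl (a, 0)) ∨
          D.circle L (.inl f) = D.circle L (.inl (a, 2)))))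
        ⟨fun _ => .inl rfl, fun h => by grind, fun h h' => by grind⟩
        (fun e => .inl (circle_opp L e).symm) (fun e => ?_) hjk
      by_cases he : e.1 = a
      · exact .inr ⟨hne L e he, hne L _ he⟩
      · rw [← hsm e he]
        exact .inl (circle_smooth L e).symm
    · cases hjk
    · cases hjk
    · rw [show l = l' from Sum.inr_injective hjk]
      exact .inl rfl
  refine ⟨fun j => ⟨?_, ?_⟩, fun j k hj => ⟨hcoarse j k, fun e => ?_⟩, iff_of_true h h'⟩
  · rintro (e | e)
    · exact .inl (hcoarse _ _ e)
    · exact .inr (hcoarse _ _ e)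
  · rw [← h', or_self]
    intro e
    rcases hfine _ _ e with e | e
    · exact .inl e
    · exact e.1
  · rcases hfine _ _ e with e | e
    · exact e
    · exact absurd e.1 hj

theorem isSurgery {L L' : Finset (Fin D.n)} {a : Fin D.n} (ha : a ∉ L) (hL : L' = insert a L) :
    IsSurgery (D.circle L) (D.circle L') (.inl (a, 0)) (.inl (a, 2)) := by
  subst hL
  have hm : ∀ b, b ≠ a → (b ∈ L ↔ b ∈ insert a L) := fun b hb => by simp [hb]
  by_cases h : D.circle L (.inl (a, 0)) = D.circle L (.inl (a, 2))
  · exact (isSurgery_of_eq (fun b hb => (hm b hb).symm)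
      (fun h' => (circle_insert_eq_iff ha).1 h' h) h).symm
  · exact isSurgery_of_eq hm h ((circle_insert_eq_iff ha).2 h)

end PlaneDiagram

theorem AGen.ne_one_iff {g : AGen} : g ≠ .one ↔ g = .X := by
  cases g <;> simp

/-! ### Tensor powers of $A$ as cyclic modules over multiplication by $X$. -/

section Labels

open Classical Function

noncomputable instance (Z : Type) [Finite Z] : Fintype (Z → AGen) := Fintype.ofFinite _

variable {S : Type} [CommRing S] {J Z Z₁ Z₂ : Type} [Fintype Z] [Fintype Z₁] [Fintype Z₂]

omit [Fintype Z] in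
theorem update_eq_update_iff_of_eq {s t : Z → AGen} {z : Z} (h : s z = t z) {g : AGen} :
    update s z g = update t z g ↔ s = t := by
  refine ⟨fun e => ?_, fun e => by rw [e]⟩
  rw [← update_eq_self z s, ← update_eq_self z t, h, ← update_idem g (t z) s,
    ← update_idem g (t z) t, e]

/-- Multiplication by `X` in the tensor factor `z` of `A^{⊗ Z}`. -/
noncomputable def labelX (z : Z) : ((Z → AGen) → S) →ₗ[S] ((Z → AGen) → S) where
  toFun f t := if t z = .X then f (update t z .one) else 0
  map_add' f g := by
    ext t
    by_cases h : t z = .X <;> simp [h]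
  map_smul' a f := by
    ext t
    by_cases h : t z = .X <;> simp [h]

omit [Fintype Z] in
theorem labelX_apply (z : Z) (f : (Z → AGen) → S) (t : Z → AGen) :
    labelX z f t = if t z = .X then f (update t z .one) else 0 := rfl

omit [Fintype Z] in
theorem labelX_comm (z w : Z) (f : (Z → AGen) → S) :
    labelX z (labelX w f) = labelX w (labelX z f) := by
  rcases eq_or_ne z w with rfl | h
  · rfl
  · ext t
    simp only [labelX_apply, update_of_ne h, update_of_ne h.symm, update_comm h]
    by_cases h1 : t z = .X <;> by_cases h2 : t w = .X <;> simp [h1, h2]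

theorem labelX_single {s : Z → AGen} {z : Z} (h : s z = .X) :
    labelX z (Pi.single (update s z .one) (1 : S)) = Pi.single s 1 := by
  ext t
  rw [labelX_apply, Pi.single_apply, Pi.single_apply]
  by_cases ht : t z = .X
  · rw [if_pos ht]
    exact if_congr (update_eq_update_iff_of_eq (ht.trans h.symm)) rfl rfl
  · rw [if_neg ht, if_neg]
    rintro rfl
    exact ht h

/-- The unit of `A^{⊗ Z}`. -/
noncomputable def labelUnit : (Z → AGen) → S := Pi.single (fun _ => .one) 1

theorem labelUnit_apply (t : Z → AGen) :
    (labelUnit t : S) = if ∀ z, t z = .one then 1 else 0 := by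
  rw [labelUnit, Pi.single_apply]
  simp only [funext_iff]

/-- Multiplication by `Δ(1)` in the tensor factors `z` and `w`. -/
noncomputable def labelDelta (c : S) (z w : Z) : ((Z → AGen) → S) →ₗ[S] ((Z → AGen) → S) :=
  labelX z + labelX w + c • (labelX z).comp (labelX w)

omit [Fintype Z] in
theorem labelDelta_apply (c : S) (z w : Z) (f : (Z → AGen) → S) :
    labelDelta c z w f = labelX z f + labelX w f + c • labelX z (labelX w f) := rfl

omit [Fintype Z] in
theorem labelDelta_swap (c : S) (z w : Z) : labelDelta c z w = labelDelta c w z := by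
  ext1 f
  rw [labelDelta_apply, labelDelta_apply, labelX_comm, add_comm (labelX z f)]

omit [Fintype Z] in
theorem labelDelta_comm (c : S) (z w z' w' : Z) (f : (Z → AGen) → S) :
    labelDelta c z w (labelDelta c z' w' f) = labelDelta c z' w' (labelDelta c z w f) := by
  have h : ∀ u v : Z, Commute (labelX u : Module.End S ((Z → AGen) → S)) (labelX v) := fun u v =>
    LinearMap.ext (labelX_comm u v)
  have h' : ∀ u, Commute (labelX u : Module.End S ((Z → AGen) → S)) (labelDelta c z' w') :=
    fun u => ((h u z').add_right (h u w')).add_right (((h u z').mul_right (h u w')).smul_right c)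
  exact LinearMap.congr_fun (((h' z).add_left (h' w)).add_left
    (((h' z).mul_left (h' w)).smul_left c)).eq f

theorem sum_labelX_mul (z : Z) (F H : (Z → AGen) → S) :
    ∑ s, H s * labelX z F s = ∑ s, (if s z = .one then H (update s z .X) else 0) * F s := by
  simp only [labelX_apply, mul_ite, mul_zero, ite_mul, zero_mul, ← Finset.sum_filter]
  refine Finset.sum_nbij' (fun s => update s z .one) (fun s => update s z .X) ?_ ?_ ?_ ?_ ?_
  · simp
  · simp
  · intro s hs
    rw [Finset.mem_filter] at hs
    rw [update_idem, ← hs.2, update_eq_self]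
  · intro s hs
    rw [Finset.mem_filter] at hs
    rw [update_idem, ← hs.2, update_eq_self]
  · intro s hs
    rw [Finset.mem_filter] at hs
    rw [update_idem, ← hs.2, update_eq_self]

omit [Fintype Z₂] in
/-- A linear map that commutes with multiplication by all `X` is determined by its value at the
unit. -/
theorem linearMap_eq_of_labelUnit {c₁ : J → Z₁} {c₂ : J → Z₂} (hc : Surjective c₁)
    {T T' : ((Z₁ → AGen) → S) →ₗ[S] ((Z₂ → AGen) → S)}
    (hT : ∀ j f, T (labelX (c₁ j) f) = labelX (c₂ j) (T f))
    (hT' : ∀ j f, T' (labelX (c₁ j) f) = labelX (c₂ j) (T' f))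
    (h : T labelUnit = T' labelUnit) : T = T' := by
  -- Every basis vector arises from the unit by multiplications by $X$: induction on the number of
  -- labels $X$.
  have key : ∀ n : ℕ, ∀ s : Z₁ → AGen, (Finset.univ.filter fun z => s z = .X).card = n →
      T (Pi.single s 1) = T' (Pi.single s 1) := by
    intro n
    induction n using Nat.strong_induction_on with
    | _ n ih =>
      intro s hs
      by_cases h1 : ∀ z, s z = .one
      · rw [show s = fun _ => .one from funext h1]
        exact h
      · push Not at h1
        obtain ⟨z, hz⟩ := h1
        rw [AGen.ne_one_iff] at hz
        obtain ⟨j, rfl⟩ := hc z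
        rw [← labelX_single hz, hT, hT']
        refine congrArg _ (ih _ ?_ _ rfl)
        rw [← hs]
        refine Finset.card_lt_card (Finset.ssubset_iff_subset_ne.2 ⟨fun w hw => ?_, fun e => ?_⟩)
        · rw [Finset.mem_filter] at hw ⊢
          refine ⟨hw.1, ?_⟩
          rcases eq_or_ne w (c₁ j) with rfl | hwz
          · exact hz
          · rw [← hw.2, update_of_ne hwz]
        · have : c₁ j ∈ Finset.univ.filter fun z => s z = .X := by simp [hz]
          rw [← e] at this
          simp at this
  exact LinearMap.pi_ext' fun s => LinearMap.ext_ring (key _ s rfl)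

end Labels

/-! ### The structure map of a surgery and its value on the unit. -/

section Surgery

open Classical Function

variable {S : Type} [CommRing S] {J Z₁ Z₂ : Type}

/-- The matrix entry of the structure map of the cube for a surgery near `x` and `y`. -/
noncomputable def surgeryCoeff (c : S) (c₁ : J → Z₁) (c₂ : J → Z₂) (x y : J) (s : Z₁ → AGen)
    (t : Z₂ → AGen) : S :=
  if ∀ j, ¬ (c₁ j = c₁ x ∨ c₁ j = c₁ y) → s (c₁ j) = t (c₂ j) then
    if c₁ x ≠ c₁ y then AGen.mulCoeff S (s (c₁ x)) (s (c₁ y)) (t (c₂ x))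
    else AGen.comulCoeff c (s (c₁ x)) (t (c₂ x)) (t (c₂ y))
  else 0

variable {c : S} {c₁ : J → Z₁} {c₂ : J → Z₂} {x y : J}

/-- Matrix form of linearity over multiplication by $X$ at the point `j`: the left side is the
transposed action on the source, the right side the action on the target. Near the surgery this is a
check of the tables of $m$ and $\Delta$; elsewhere both sides force the label at `j` to be $\mathbf
1$ in the source and $X$ in the target. -/
theorem IsSurgery.surgeryCoeff_update (h : IsSurgery c₁ c₂ x y) (s : Z₁ → AGen) (t : Z₂ → AGen)
    (j : J) :
    (if s (c₁ j) = .one then surgeryCoeff c c₁ c₂ x y (update s (c₁ j) .X) t else 0) =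
      if t (c₂ j) = .X then surgeryCoeff c c₁ c₂ x y s (update t (c₂ j) .one) else 0 := by
  by_cases hj : c₁ j = c₁ x ∨ c₁ j = c₁ y
  · have hj2 := (h.near_iff j).1 hj
    have e1 : (∀ k, ¬ (c₁ k = c₁ x ∨ c₁ k = c₁ y) → update s (c₁ j) .X (c₁ k) = t (c₂ k)) ↔
        ∀ k, ¬ (c₁ k = c₁ x ∨ c₁ k = c₁ y) → s (c₁ k) = t (c₂ k) := by
      refine forall_congr' fun k => imp_congr_right fun hk => ?_
      rw [update_of_ne]
      intro e
      exact hk (by rwa [e])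
    have e2 : (∀ k, ¬ (c₁ k = c₁ x ∨ c₁ k = c₁ y) → s (c₁ k) = update t (c₂ j) .one (c₂ k)) ↔
        ∀ k, ¬ (c₁ k = c₁ x ∨ c₁ k = c₁ y) → s (c₁ k) = t (c₂ k) := by
      refine forall_congr' fun k => imp_congr_right fun hk => ?_
      rw [update_of_ne]
      intro e
      rw [h.near_iff] at hk
      exact hk (by rwa [e])
    rw [surgeryCoeff, surgeryCoeff, e1, e2]
    by_cases ha : ∀ k, ¬ (c₁ k = c₁ x ∨ c₁ k = c₁ y) → s (c₁ k) = t (c₂ k)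
    · rw [if_pos ha, if_pos ha]
      by_cases hm : c₁ x ≠ c₁ y
      · have hm2 := h.ne_iff.1 hm
        have hj2' : c₂ j = c₂ y := by rwa [hm2, or_self] at hj2
        rw [if_pos hm, if_pos hm, hj2', hm2, update_self]
        rcases hj with e | e
        · rw [e, update_self, update_of_ne hm.symm]
          cases s (c₁ x) <;> cases s (c₁ y) <;> cases t (c₂ y) <;> simp [AGen.mulCoeff]
        · rw [e, update_self, update_of_ne hm]
          cases s (c₁ x) <;> cases s (c₁ y) <;> cases t (c₂ y) <;> simp [AGen.mulCoeff]
      · have hm2 : c₂ x ≠ c₂ y := fun e => hm (h.ne_iff.2 e)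
        rw [if_neg hm, if_neg hm]
        rw [not_not] at hm
        rw [hm, or_self] at hj
        rw [hj, hm, update_self]
        rcases hj2 with e | e
        · rw [e, update_self, update_of_ne hm2.symm]
          cases s (c₁ y) <;> cases t (c₂ x) <;> cases t (c₂ y) <;> simp [AGen.comulCoeff]
        · rw [e, update_self, update_of_ne hm2]
          cases s (c₁ y) <;> cases t (c₂ x) <;> cases t (c₂ y) <;> simp [AGen.comulCoeff]
    · rw [if_neg ha, if_neg ha]
      simp
  · have hj2 : ¬ (c₂ j = c₂ x ∨ c₂ j = c₂ y) := fun e => hj ((h.near_iff j).2 e)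
    have e1 : (∀ k, ¬ (c₁ k = c₁ x ∨ c₁ k = c₁ y) → update s (c₁ j) .X (c₁ k) = t (c₂ k)) ↔
        t (c₂ j) = .X ∧
          ∀ k, ¬ (c₁ k = c₁ x ∨ c₁ k = c₁ y) → c₁ k ≠ c₁ j → s (c₁ k) = t (c₂ k) := by
      constructor
      · intro ha
        refine ⟨by simpa using (ha j hj).symm, fun k hk hkj => ?_⟩
        simpa [update_of_ne hkj] using ha k hk
      · rintro ⟨h1, ha⟩ k hk
        by_cases hkj : c₁ k = c₁ j
        · rw [hkj, update_self, ((h.eq_iff k j hk).1 hkj), h1]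
        · rw [update_of_ne hkj]
          exact ha k hk hkj
    have e2 : (∀ k, ¬ (c₁ k = c₁ x ∨ c₁ k = c₁ y) → s (c₁ k) = update t (c₂ j) .one (c₂ k)) ↔
        s (c₁ j) = .one ∧
          ∀ k, ¬ (c₁ k = c₁ x ∨ c₁ k = c₁ y) → c₁ k ≠ c₁ j → s (c₁ k) = t (c₂ k) := by
      constructor
      · intro ha
        refine ⟨by simpa using ha j hj, fun k hk hkj => ?_⟩
        rw [Ne, h.eq_iff k j hk] at hkj
        simpa [update_of_ne hkj] using ha k hk
      · rintro ⟨h1, ha⟩ k hk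
        by_cases hkj : c₁ k = c₁ j
        · rw [(h.eq_iff k j hk).1 hkj, update_self, hkj, h1]
        · rw [update_of_ne fun e => hkj ((h.eq_iff k j hk).2 e)]
          exact ha k hk hkj
    simp only [not_or] at hj hj2
    rw [surgeryCoeff, surgeryCoeff, e1, e2, update_of_ne (Ne.symm hj.1), update_of_ne (Ne.symm hj.2),
      update_of_ne (Ne.symm hj2.1), update_of_ne (Ne.symm hj2.2)]
    by_cases h1 : s (c₁ j) = .one <;> by_cases h2 : t (c₂ j) = .X <;> simp [h1, h2]

variable [Fintype Z₁] [Fintype Z₂]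

/-- The structure map of the cube for a surgery near `x` and `y`. -/
noncomputable def surgeryMap (c : S) (c₁ : J → Z₁) (c₂ : J → Z₂) (x y : J) :
    ((Z₁ → AGen) → S) →ₗ[S] ((Z₂ → AGen) → S) :=
  Matrix.mulVecLin <| Matrix.of fun t s => surgeryCoeff c c₁ c₂ x y s t

omit [Fintype Z₂] in
theorem surgeryMap_apply (f : (Z₁ → AGen) → S) (t : Z₂ → AGen) :
    surgeryMap c c₁ c₂ x y f t = ∑ s, surgeryCoeff c c₁ c₂ x y s t * f s := rfl

omit [Fintype Z₂] in
theorem surgeryMap_single (s : Z₁ → AGen) (t : Z₂ → AGen) :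
    surgeryMap c c₁ c₂ x y (Pi.single s 1) t = surgeryCoeff c c₁ c₂ x y s t := by
  rw [surgeryMap_apply, Finset.sum_eq_single s] <;> simp +contextual

namespace IsSurgery

variable (h : IsSurgery c₁ c₂ x y)

include h

omit [Fintype Z₂] in
theorem surgeryMap_labelX (j : J) (f : (Z₁ → AGen) → S) :
    surgeryMap c c₁ c₂ x y (labelX (c₁ j) f) = labelX (c₂ j) (surgeryMap c c₁ c₂ x y f) := by
  ext t
  rw [labelX_apply, surgeryMap_apply, surgeryMap_apply, sum_labelX_mul]
  simp only [h.surgeryCoeff_update]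
  by_cases ht : t (c₂ j) = .X <;> simp [ht]

omit [Fintype Z₂] in
theorem surgeryMap_labelDelta (j k : J) (f : (Z₁ → AGen) → S) :
    surgeryMap c c₁ c₂ x y (labelDelta c (c₁ j) (c₁ k) f) =
      labelDelta c (c₂ j) (c₂ k) (surgeryMap c c₁ c₂ x y f) := by
  simp only [labelDelta_apply, map_add, map_smul, h.surgeryMap_labelX]

theorem surgeryMap_labelUnit_of_ne (h₂ : Surjective c₂) (hm : c₁ x ≠ c₁ y) :
    surgeryMap c c₁ c₂ x y labelUnit = labelUnit := by
  ext t
  have hm2 := h.ne_iff.1 hm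
  rw [labelUnit_apply, labelUnit, surgeryMap_single, surgeryCoeff, if_pos hm]
  have e : (∀ z, t z = .one) ↔
      (∀ j, ¬ (c₁ j = c₁ x ∨ c₁ j = c₁ y) → AGen.one = t (c₂ j)) ∧ t (c₂ x) = .one := by
    refine ⟨fun ht => ⟨fun j _ => (ht _).symm, ht _⟩, ?_⟩
    rintro ⟨ht, hx⟩ z
    obtain ⟨j, rfl⟩ := h₂ z
    by_cases hj : c₁ j = c₁ x ∨ c₁ j = c₁ y
    · rw [h.near_iff, ← hm2, or_self] at hj
      rwa [hj]
    · exact (ht j hj).symm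
  rw [if_congr e rfl rfl]
  cases t (c₂ x) <;> simp [AGen.mulCoeff]

theorem surgeryMap_labelUnit_of_eq (h₂ : Surjective c₂) (hm : c₁ x = c₁ y) :
    surgeryMap c c₁ c₂ x y labelUnit = labelDelta c (c₂ x) (c₂ y) labelUnit := by
  ext t
  have hm2 : c₂ x ≠ c₂ y := fun e => h.ne_iff.2 e hm
  have e : (∀ j, ¬ (c₁ j = c₁ x ∨ c₁ j = c₁ y) → AGen.one = t (c₂ j)) ↔
      ∀ z, z ≠ c₂ x → z ≠ c₂ y → t z = .one := by
    rw [h₂.forall]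
    refine forall_congr' fun j => ?_
    rw [h.near_iff, not_or, and_imp, eq_comm (a := AGen.one)]
  have e1 : (∀ z, z ≠ c₂ x → t z = .one) ↔
      t (c₂ y) = .one ∧ ∀ z, z ≠ c₂ x → z ≠ c₂ y → t z = .one := by
    refine ⟨fun ht => ⟨ht _ hm2.symm, fun z hz _ => ht z hz⟩, fun ht z hz => ?_⟩
    rcases eq_or_ne z (c₂ y) with rfl | hz'
    · exact ht.1
    · exact ht.2 z hz hz'
  have e2 : (∀ z, z ≠ c₂ y → t z = .one) ↔
      t (c₂ x) = .one ∧ ∀ z, z ≠ c₂ x → z ≠ c₂ y → t z = .one := by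
    refine ⟨fun ht => ⟨ht _ hm2, fun z _ hz => ht z hz⟩, fun ht z hz => ?_⟩
    rcases eq_or_ne z (c₂ x) with rfl | hz'
    · exact ht.1
    · exact ht.2 z hz' hz
  have e3 : (∀ z, z ≠ c₂ y → update t (c₂ x) .one z = .one) ↔
      ∀ z, z ≠ c₂ x → z ≠ c₂ y → t z = .one := by
    refine forall_congr' fun z => ?_
    rcases eq_or_ne z (c₂ x) with rfl | hz
    · simp
    · simp [hz]
  have e4 : surgeryMap c c₁ c₂ x y labelUnit t = surgeryCoeff c c₁ c₂ x y (fun _ => .one) t :=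
    surgeryMap_single _ _
  rw [e4, surgeryCoeff, if_neg (not_not.2 hm), labelDelta_apply]
  simp only [Pi.add_apply, Pi.smul_apply, labelX_apply, labelUnit_apply, update_of_ne hm2.symm,
    forall_update_iff _ fun _ g => g = AGen.one, true_and, e, e1, e2, e3, smul_eq_mul]
  cases t (c₂ x) <;> cases t (c₂ y) <;> simp [AGen.comulCoeff]

/-- Circles away from the surgery correspond bijectively. With constant functions this counts
circles, with label degrees it gives homogeneity. -/
theorem sum_eq_of_ne (h₁ : Surjective c₁) (h₂ : Surjective c₂) (hm : c₁ x ≠ c₁ y) (F : Z₁ → ℤ)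
    (G : Z₂ → ℤ) (hFG : ∀ j, ¬ (c₁ j = c₁ x ∨ c₁ j = c₁ y) → F (c₁ j) = G (c₂ j)) :
    ∑ z, F z + G (c₂ x) = ∑ z, G z + F (c₁ x) + F (c₁ y) := by
  have hm2 := h.ne_iff.1 hm
  have e1 : (Finset.univ.filter fun z => z = c₁ x ∨ z = c₁ y) = {c₁ x, c₁ y} := by
    ext z
    simp
  have e2 : (Finset.univ.filter fun z => z = c₂ x ∨ z = c₂ y) = {c₂ x} := by
    ext z
    simp [← hm2]
  rw [← Finset.sum_filter_add_sum_filter_not Finset.univ (fun z => z = c₁ x ∨ z = c₁ y) F,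
    ← Finset.sum_filter_add_sum_filter_not Finset.univ (fun z => z = c₂ x ∨ z = c₂ y) G, e1, e2,
    Finset.sum_pair hm, Finset.sum_singleton]
  have : ∑ z with ¬ (z = c₁ x ∨ z = c₁ y), F z = ∑ z with ¬ (z = c₂ x ∨ z = c₂ y), G z := by
    refine Finset.sum_nbij (fun z => c₂ (surjInv h₁ z)) ?_ ?_ ?_ ?_
    · rw [h₁.forall]
      intro j hj
      have e := surjInv_eq h₁ (c₁ j)
      rw [Finset.mem_filter, ← e] at hj
      simpa [h.near_iff] using hj
    · intro z hz w hw hzw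
      rw [Finset.mem_coe, Finset.mem_filter, ← surjInv_eq h₁ z] at hz
      rw [← surjInv_eq h₁ z, ← surjInv_eq h₁ w]
      exact (h.eq_iff _ _ hz.2).2 hzw
    · intro w hw
      obtain ⟨j, rfl⟩ := h₂ w
      rw [Finset.mem_coe, Finset.mem_filter, ← h.near_iff] at hw
      refine ⟨c₁ j, by simpa using hw.2, Eq.symm ?_⟩
      exact (h.eq_iff _ _ hw.2).1 (surjInv_eq h₁ _).symm
    · intro z hz
      rw [Finset.mem_filter] at hz
      have := hFG (surjInv h₁ z)
      rw [surjInv_eq h₁ z] at this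
      exact this hz.2
  rw [this]
  ring

theorem card_of_ne (h₁ : Surjective c₁) (h₂ : Surjective c₂) (hm : c₁ x ≠ c₁ y) :
    Fintype.card Z₁ = Fintype.card Z₂ + 1 := by
  have := h.sum_eq_of_ne h₁ h₂ hm (fun _ => 1) (fun _ => 1) fun _ _ => rfl
  simp only [Finset.sum_const, Finset.card_univ, nsmul_eq_mul, mul_one] at this
  lia

theorem card_of_eq (h₁ : Surjective c₁) (h₂ : Surjective c₂) (hm : c₁ x = c₁ y) :
    Fintype.card Z₂ = Fintype.card Z₁ + 1 :=
  h.symm.card_of_ne h₂ h₁ fun e => h.ne_iff.2 e hm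

end IsSurgery

end Surgery

/-! ### Commutativity of the squares of the cube. -/

section Square

variable {S : Type} [CommRing S] {c : S} {J Z₀ Z₁ Z₂ Z₃ : Type} [Fintype Z₀] [Fintype Z₁]
  [Fintype Z₂] [Fintype Z₃] {c₀ : J → Z₀} {c₁ : J → Z₁} {c₂ : J → Z₂} {c₃ : J → Z₃} {x y x' y' : J}

open Classical Function

theorem surgeryMap_surgeryMap_labelUnit (h₁ : Surjective c₁) (h₃ : Surjective c₃)
    (h01 : IsSurgery c₀ c₁ x y) (h13 : IsSurgery c₁ c₃ x' y') :
    surgeryMap c c₁ c₃ x' y' (surgeryMap c c₀ c₁ x y labelUnit) =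
      (if c₀ x = c₀ y then labelDelta c (c₃ x) (c₃ y) else LinearMap.id)
        ((if c₁ x' = c₁ y' then labelDelta c (c₃ x') (c₃ y') else LinearMap.id) labelUnit) := by
  have e : surgeryMap c c₁ c₃ x' y' labelUnit =
      (if c₁ x' = c₁ y' then labelDelta c (c₃ x') (c₃ y') else LinearMap.id) labelUnit := by
    split_ifs with h
    · exact h13.surgeryMap_labelUnit_of_eq h₃ h
    · exact h13.surgeryMap_labelUnit_of_ne h₃ h
  rw [← e]
  split_ifs with h
  · rw [h01.surgeryMap_labelUnit_of_eq h₁ h, h13.surgeryMap_labelDelta]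
  · rw [h01.surgeryMap_labelUnit_of_ne h₁ h, LinearMap.id_apply]

theorem labelDelta_eq_of_mem {Z : Type} {a b a' b' : Z} (ha : a = a' ∨ a = b')
    (hb : b = a' ∨ b = b') (h : a = b ↔ a' = b') :
    (labelDelta c a b : ((Z → AGen) → S) →ₗ[S] _) = labelDelta c a' b' := by
  rcases ha with rfl | rfl <;> rcases hb with rfl | rfl
  · rw [← h.1 rfl]
  · rfl
  · exact labelDelta_swap c _ _
  · rw [h.1 rfl]

/-- The squares of the cube commute before the signs are introduced. -/
theorem surgeryMap_comp_comm (h₀ : Surjective c₀) (h₁ : Surjective c₁) (h₂ : Surjective c₂)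
    (h₃ : Surjective c₃) (h01 : IsSurgery c₀ c₁ x y) (h13 : IsSurgery c₁ c₃ x' y')
    (h02 : IsSurgery c₀ c₂ x' y') (h23 : IsSurgery c₂ c₃ x y) :
    (surgeryMap c c₁ c₃ x' y').comp (surgeryMap c c₀ c₁ x y) =
      (surgeryMap c c₂ c₃ x y).comp (surgeryMap c c₀ c₂ x' y') := by
  refine linearMap_eq_of_labelUnit (c₂ := c₃) h₀ (fun j f => ?_) (fun j f => ?_) ?_
  · simp only [LinearMap.comp_apply, h01.surgeryMap_labelX, h13.surgeryMap_labelX]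
  · simp only [LinearMap.comp_apply, h02.surgeryMap_labelX, h23.surgeryMap_labelX]
  simp only [LinearMap.comp_apply]
  rw [surgeryMap_surgeryMap_labelUnit h₁ h₃ h01 h13, surgeryMap_surgeryMap_labelUnit h₂ h₃ h02 h23]
  have k01 := h01.card_of_eq h₀ h₁
  have k01' := h01.card_of_ne h₀ h₁
  have k13 := h13.card_of_eq h₁ h₃
  have k13' := h13.card_of_ne h₁ h₃
  have k02 := h02.card_of_eq h₀ h₂
  have k02' := h02.card_of_ne h₀ h₂
  have k23 := h23.card_of_eq h₂ h₃
  have k23' := h23.card_of_ne h₂ h₃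
  -- A surgery that alters whether `x'` and `y'` share a circle must involve their circles, so
  -- afterwards `x` and `y` lie on those circles.
  have near : ¬ (c₀ x' = c₀ y' ↔ c₁ x' = c₁ y') →
      (c₁ x = c₁ x' ∨ c₁ x = c₁ y') ∧ (c₁ y = c₁ x' ∨ c₁ y = c₁ y') := by
    have a1 := h01.eq_iff x' y'
    have a2 := h01.eq_iff y' x'
    have a3 := h01.near_iff x'
    have a4 := h01.near_iff y'
    have a5 := h01.ne_iff
    grind
  have near₃ : ∀ j, c₁ j = c₁ x' ∨ c₁ j = c₁ y' → c₃ j = c₃ x' ∨ c₃ j = c₃ y' := fun j =>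
    (h13.near_iff j).1
  have n13 := h13.ne_iff
  have n23 := h23.ne_iff
  -- The number of circles in `Z₃` is the same along both paths. If the surgery at `x', y'` has the
  -- same type on both sides of the square, so does the other one, and the factors $\Delta(\mathbf
  -- 1)$ commute. If its type differs, the two first surgeries have equal type, as have the two
  -- second ones, and the possible factors $\Delta(\mathbf 1)$ coincide in `Z₃`.
  by_cases hB : c₀ x' = c₀ y' ↔ c₁ x' = c₁ y'
  · have hA : c₀ x = c₀ y ↔ c₂ x = c₂ y := by
      clear near near₃ n13 n23
      by_cases A1 : c₀ x = c₀ y <;> by_cases A2 : c₂ x = c₂ y <;> grind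
    rw [if_congr hA rfl rfl, if_congr hB rfl rfl]
    split_ifs
    · exact labelDelta_comm _ _ _ _ _ _
    · rfl
    · rfl
    · rfl
  · have hA : (c₀ x = c₀ y ↔ c₀ x' = c₀ y') ∧ (c₂ x = c₂ y ↔ c₁ x' = c₁ y') := by
      clear near near₃ n13 n23
      by_cases A1 : c₀ x = c₀ y <;> by_cases A2 : c₂ x = c₂ y <;> grind
    have e : (labelDelta c (c₃ x) (c₃ y) : ((Z₃ → AGen) → S) →ₗ[S] _) =
        labelDelta c (c₃ x') (c₃ y') :=
      labelDelta_eq_of_mem (near₃ _ (near hB).1) (near₃ _ (near hB).2)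
        (by rw [← n13, ← n23, Ne, Ne, hA.2])
    rw [if_congr hA.1 rfl rfl, if_congr hA.2 rfl rfl, e]

end Square

/-! ### Signs, and the vanishing of the square of the differential. -/

namespace PlaneDiagram

variable {D : PlaneDiagram} {S : Type} [CommRing S]

open Classical in
theorem edgeCoeff_eq_surgeryCoeff (c : S) (a : Fin D.n) (s t : D.State) :
    D.edgeCoeff c a s t = surgeryCoeff c (D.circle s.1) (D.circle t.1) (.inl (a, 0)) (.inl (a, 2))
      s.2 t.2 := by
  have h1 : D.circle s.1 (.inl (a, 0)) ≠ D.circle s.1 (.inl (a, 2)) ↔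
      (Quot.mk _ (a, 0) : D.Curve s.1) ≠ Quot.mk _ (a, 2) := Sum.inl_injective.ne_iff
  have h2 : (∀ j, ¬ (D.circle s.1 j = D.circle s.1 (.inl (a, 0)) ∨
        D.circle s.1 j = D.circle s.1 (.inl (a, 2))) → s.2 (D.circle s.1 j) = t.2 (D.circle t.1 j)) ↔
      (∀ e : Fin D.n × Fin 4, (Quot.mk _ e : D.Curve s.1) ≠ Quot.mk _ (a, 0) →
        (Quot.mk _ e : D.Curve s.1) ≠ Quot.mk _ (a, 2) →
          s.2 (.inl (Quot.mk _ e)) = t.2 (.inl (Quot.mk _ e))) ∧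
      ∀ l : Fin D.loops, s.2 (.inr l) = t.2 (.inr l) := by
    rw [Sum.forall]
    simp only [circle, Sum.map_inl, Sum.map_inr, Sum.inl.injEq, reduceCtorEq, not_or, and_imp,
      not_false_eq_true, or_self, forall_const, id, Ne]
  unfold edgeCoeff surgeryCoeff
  dsimp only
  by_cases H : ∀ j, ¬ (D.circle s.1 j = D.circle s.1 (.inl (a, 0)) ∨
      D.circle s.1 j = D.circle s.1 (.inl (a, 2))) → s.2 (D.circle s.1 j) = t.2 (D.circle t.1 j)
  · rw [if_pos H, if_pos (h2.1 H)]
    by_cases H1 : D.circle s.1 (.inl (a, 0)) ≠ D.circle s.1 (.inl (a, 2))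
    · rw [if_pos H1, if_pos (h1.1 H1)]
      rfl
    · rw [if_neg H1, if_neg fun h => H1 (h1.2 h)]
      rfl
  · rw [if_neg H, if_neg fun h => H (h2.2 h)]

variable (D) in
/-- The sign in the structure map `L ↦ L ∪ {a}` of the skew cube. -/
def edgeSign (S : Type) [CommRing S] (L : Finset (Fin D.n)) (a : Fin D.n) : S :=
  (-1) ^ (L.filter (a < ·)).card

/-- The part at the double point `a` of the matrix entry of the differential. -/
noncomputable def signedEdgeCoeff (c : S) (a : Fin D.n) (s t : D.State) : S :=
  if a ∉ s.1 ∧ t.1 = insert a s.1 then D.edgeSign S s.1 a * D.edgeCoeff c a s t else 0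

theorem diff_apply (c : S) (f : D.State → S) (t : D.State) :
    D.diff c f t = ∑ s, ((-1) ^ D.x * ∑ a, signedEdgeCoeff c a s t) * f s := by
  simp only [signedEdgeCoeff, ← Finset.sum_filter]
  rfl

/-- Adding the larger point `b` changes the sign at `a`, while adding `a` leaves the sign at `b`
alone. -/
theorem edgeSign_mul_edgeSign_insert {L : Finset (Fin D.n)} {a b : Fin D.n} (hab : a < b) :
    D.edgeSign S L a * D.edgeSign S (insert a L) b =
      - (D.edgeSign S L b * D.edgeSign S (insert b L) a) ∨ b ∈ L := by
  by_cases hb : b ∈ L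
  · exact .inr hb
  · left
    simp only [edgeSign, Finset.filter_insert, hab, hab.not_gt, if_true, if_false]
    rw [Finset.card_insert_of_notMem (by simp [hb]), pow_succ]
    ring

theorem edgeSign_antisymm {L : Finset (Fin D.n)} {a b : Fin D.n} (ha : a ∉ L) (hb : b ∉ L)
    (hab : a ≠ b) :
    D.edgeSign S L a * D.edgeSign S (insert a L) b =
      - (D.edgeSign S L b * D.edgeSign S (insert b L) a) := by
  rcases lt_or_gt_of_ne hab with h | h
  · exact (edgeSign_mul_edgeSign_insert h).resolve_right hb
  · rw [(edgeSign_mul_edgeSign_insert h).resolve_right ha, neg_neg]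

open Classical in
theorem sum_edgeCoeff_mul (c : S) {L : Finset (Fin D.n)} (s u : D.State) (a b : Fin D.n) :
    ∑ l : D.Circle L → AGen, D.edgeCoeff c a s ⟨L, l⟩ * D.edgeCoeff c b ⟨L, l⟩ u =
      surgeryMap c (D.circle L) (D.circle u.1) (.inl (b, 0)) (.inl (b, 2))
        (surgeryMap c (D.circle s.1) (D.circle L) (.inl (a, 0)) (.inl (a, 2))
          (Pi.single s.2 1)) u.2 := by
  rw [surgeryMap_apply]
  refine Finset.sum_congr rfl fun l _ => ?_
  rw [surgeryMap_single, edgeCoeff_eq_surgeryCoeff, edgeCoeff_eq_surgeryCoeff, mul_comm]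

open Classical in
theorem sum_signedEdgeCoeff_mul (c : S) (s u : D.State) (a b : Fin D.n) :
    ∑ t, signedEdgeCoeff c a s t * signedEdgeCoeff c b t u =
      if a ∉ s.1 ∧ b ∉ insert a s.1 ∧ u.1 = insert b (insert a s.1) then
        D.edgeSign S s.1 a * D.edgeSign S (insert a s.1) b *
          ∑ l : D.Circle (insert a s.1) → AGen,
            D.edgeCoeff c a s ⟨insert a s.1, l⟩ * D.edgeCoeff c b ⟨insert a s.1, l⟩ u
      else 0 := by
  rw [← Fintype.sum_of_injective (Sigma.mk (insert a s.1) : _ → D.State) sigma_mk_injective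
    (fun l => signedEdgeCoeff c a s ⟨insert a s.1, l⟩ * signedEdgeCoeff c b ⟨insert a s.1, l⟩ u)]
  · simp only [signedEdgeCoeff, and_true]
    by_cases h1 : a ∉ s.1
    · by_cases h2 : b ∉ insert a s.1 ∧ u.1 = insert b (insert a s.1)
      · simp only [h1, h2, if_true, not_false_eq_true, and_self, Finset.mul_sum]
        exact Finset.sum_congr rfl fun l _ => by ring
      · simp only [h1, h2, if_false, not_false_eq_true, true_and, mul_zero, Finset.sum_const_zero]
    · simp [h1]
  · rintro ⟨L, l⟩ hL
    rw [signedEdgeCoeff, if_neg, zero_mul]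
    rintro ⟨-, e⟩
    dsimp only at e
    subst e
    exact hL ⟨l, rfl⟩
  · exact fun _ => rfl

theorem sum_signedEdgeCoeff_mul_self (c : S) (s u : D.State) (a : Fin D.n) :
    ∑ t, signedEdgeCoeff c a s t * signedEdgeCoeff c a t u = 0 := by
  rw [sum_signedEdgeCoeff_mul, if_neg]
  simp

open Classical in
theorem sum_signedEdgeCoeff_mul_antisymm (c : S) (s u : D.State) (a b : Fin D.n) :
    ∑ t, signedEdgeCoeff c a s t * signedEdgeCoeff c b t u +
      ∑ t, signedEdgeCoeff c b s t * signedEdgeCoeff c a t u = 0 := by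
  rcases eq_or_ne a b with rfl | hab
  · rw [sum_signedEdgeCoeff_mul_self, add_zero]
  rw [sum_signedEdgeCoeff_mul, sum_signedEdgeCoeff_mul]
  have hiff : (a ∉ s.1 ∧ b ∉ insert a s.1 ∧ u.1 = insert b (insert a s.1)) ↔
      (b ∉ s.1 ∧ a ∉ insert b s.1 ∧ u.1 = insert a (insert b s.1)) := by
    rw [Finset.insert_comm b a]
    simp only [Finset.mem_insert, not_or]
    tauto
  by_cases h : a ∉ s.1 ∧ b ∉ insert a s.1 ∧ u.1 = insert b (insert a s.1)
  · have h' := hiff.1 h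
    rw [if_pos h, if_pos h', edgeSign_antisymm h.1 h'.1 hab, sum_edgeCoeff_mul, sum_edgeCoeff_mul]
    have := surgeryMap_comp_comm (c := c) (D.circle_surjective s.1)
      (D.circle_surjective (insert a s.1)) (D.circle_surjective (insert b s.1))
      (D.circle_surjective u.1) (isSurgery h.1 rfl) (isSurgery h.2.1 h.2.2)
      (isSurgery h'.1 rfl) (isSurgery h'.2.1 h'.2.2)
    have := congrFun (LinearMap.congr_fun this (Pi.single s.2 1)) u.2
    simp only [LinearMap.comp_apply] at this
    rw [this]
    ring
  · rw [if_neg h, if_neg fun h' => h (hiff.2 h'), add_zero]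

/-- The pairs $(a,b)$ and $(b,a)$ cancel, and the diagonal terms vanish because a point can be added
only once. -/
theorem sum_sum_signedEdgeCoeff_mul (c : S) (s u : D.State) :
    ∑ t, (∑ a, signedEdgeCoeff c a s t) * ∑ b, signedEdgeCoeff c b t u = 0 := by
  simp only [Finset.sum_mul_sum]
  rw [Finset.sum_comm]
  have : ∀ a, ∑ t, ∑ b, signedEdgeCoeff c a s t * signedEdgeCoeff c b t u =
      ∑ b, ∑ t, signedEdgeCoeff c a s t * signedEdgeCoeff c b t u := fun a => Finset.sum_comm
  simp only [this]
  rw [← Finset.sum_product']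
  refine Finset.sum_involution (fun p _ => p.swap) (fun p _ => ?_) (fun p _ hp e => hp ?_)
    (fun _ _ => Finset.mem_univ _) fun p _ => p.swap_swap
  · exact sum_signedEdgeCoeff_mul_antisymm c s u p.1 p.2
  · have : p.1 = p.2 := (congrArg Prod.fst e).symm
    rw [this, sum_signedEdgeCoeff_mul_self]

/-- The differential has square zero. -/
theorem diff_diff (c : S) (f : D.State → S) : D.diff c (D.diff c f) = 0 := by
  ext u
  rw [diff_apply]
  simp only [diff_apply c f, Finset.mul_sum]
  rw [Finset.sum_comm]
  refine Finset.sum_eq_zero fun s _ => ?_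
  have := sum_sum_signedEdgeCoeff_mul c s u
  calc _ = (-1) ^ D.x * (-1) ^ D.x * f s *
        ∑ t, (∑ a, signedEdgeCoeff c a s t) * ∑ b, signedEdgeCoeff c b t u := by
        rw [Finset.mul_sum]
        exact Finset.sum_congr rfl fun t _ => by simp only [← Finset.mul_sum]; ring
    _ = 0 := by rw [this, mul_zero]

end PlaneDiagram

/-! ### Expansion of the complex and its differential in powers of $c$. -/

section Coefficients

open Polynomial

theorem AGen.deg_of_mulCoeff_ne_zero {a b g : AGen} {k : ℕ}
    (h : (AGen.mulCoeff ℤ[X] a b g).coeff k ≠ 0) : g.deg + 1 + 2 * (k : ℤ) = a.deg + b.deg := by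
  cases a <;> cases b <;> cases g <;> simp [AGen.mulCoeff, coeff_one, AGen.deg] at h ⊢ <;> lia

theorem AGen.deg_of_comulCoeff_ne_zero {a b g : AGen} {k : ℕ}
    (h : (AGen.comulCoeff (Polynomial.X : ℤ[X]) g a b).coeff k ≠ 0) :
    a.deg + b.deg + 1 + 2 * (k : ℤ) = g.deg := by
  cases a <;> cases b <;> cases g <;>
    simp [AGen.comulCoeff, coeff_one, coeff_X, AGen.deg] at h ⊢ <;> lia

-- With $\deg c=2$ both $m$ and $\Delta$ lower the degree by one; the shift by the size of `L`
-- compensates for this.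
open Classical in
theorem IsSurgery.sum_deg {J Z₁ Z₂ : Type} [Fintype Z₁] [Fintype Z₂] {c₁ : J → Z₁} {c₂ : J → Z₂}
    {x y : J} (h : IsSurgery c₁ c₂ x y) (h₁ : Function.Surjective c₁) (h₂ : Function.Surjective c₂)
    {s : Z₁ → AGen} {t : Z₂ → AGen} {k : ℕ}
    (hk : (surgeryCoeff (X : ℤ[X]) c₁ c₂ x y s t).coeff k ≠ 0) :
    ∑ z, (t z).deg + 1 + 2 * (k : ℤ) = ∑ z, (s z).deg := by
  rw [surgeryCoeff] at hk
  by_cases ha : ∀ j, ¬ (c₁ j = c₁ x ∨ c₁ j = c₁ y) → s (c₁ j) = t (c₂ j)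
  · rw [if_pos ha] at hk
    by_cases hm : c₁ x ≠ c₁ y
    · rw [if_pos hm] at hk
      have h1 := h.sum_eq_of_ne h₁ h₂ hm (fun z => (s z).deg) (fun z => (t z).deg)
        fun j hj => congrArg _ (ha j hj)
      have h2 := AGen.deg_of_mulCoeff_ne_zero hk
      lia
    · rw [if_neg hm] at hk
      have h1 := h.symm.sum_eq_of_ne h₂ h₁ (fun e => hm (h.ne_iff.2 e)) (fun z => (t z).deg)
        (fun z => (s z).deg) fun j hj => congrArg _ (ha j (by rwa [h.near_iff])).symm
      have h2 := AGen.deg_of_comulCoeff_ne_zero hk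
      lia
  · rw [if_neg ha, coeff_zero] at hk
    exact absurd rfl hk

theorem Polynomial.natDegree_neg_one_pow_mul_le {p : ℤ[X]} {k : ℕ} (hp : p.natDegree ≤ k) (n : ℕ) :
    ((-1) ^ n * p).natDegree ≤ k := by
  rcases neg_one_pow_eq_or ℤ[X] n with e | e <;> simpa [e] using hp

theorem AGen.natDegree_mulCoeff_le (a b g : AGen) : (AGen.mulCoeff ℤ[X] a b g).natDegree ≤ 1 := by
  cases a <;> cases b <;> cases g <;> simp [AGen.mulCoeff]

theorem AGen.natDegree_comulCoeff_le (a b g : AGen) :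
    (AGen.comulCoeff (Polynomial.X : ℤ[X]) a b g).natDegree ≤ 1 := by
  cases a <;> cases b <;> cases g <;> simp [AGen.comulCoeff]

theorem AGen.coeff_zero_mulCoeff (a b g : AGen) :
    (AGen.mulCoeff ℤ[X] a b g).coeff 0 = AGen.mulCoeff ℤ a b g := by
  cases a <;> cases b <;> cases g <;> simp [AGen.mulCoeff]

theorem AGen.coeff_zero_comulCoeff (a b g : AGen) :
    (AGen.comulCoeff (Polynomial.X : ℤ[X]) a b g).coeff 0 = AGen.comulCoeff (0 : ℤ) a b g := by
  cases a <;> cases b <;> cases g <;> simp [AGen.comulCoeff]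

namespace PlaneDiagram

variable (D : PlaneDiagram)

/-- The matrix of the differential of `C(D)`. -/
noncomputable def entry {S : Type} [CommRing S] (c : S) (s t : D.State) : S :=
  (-1) ^ D.x * ∑ a, signedEdgeCoeff c a s t

theorem d_apply (f : D.State → ℤ[X]) (t : D.State) : D.d f t = ∑ s, D.entry X s t * f s :=
  diff_apply _ _ _

theorem del_apply (f : D.State → ℤ) (t : D.State) : D.del f t = ∑ s, D.entry 0 s t * f s :=
  diff_apply _ _ _

variable {D}

theorem natDegree_edgeCoeff_le (a : Fin D.n) (s t : D.State) :
    (D.edgeCoeff (X : ℤ[X]) a s t).natDegree ≤ 1 := by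
  rw [edgeCoeff_eq_surgeryCoeff, surgeryCoeff]
  split_ifs
  · exact AGen.natDegree_mulCoeff_le _ _ _
  · exact AGen.natDegree_comulCoeff_le _ _ _
  · simp

theorem coeff_zero_edgeCoeff (a : Fin D.n) (s t : D.State) :
    (D.edgeCoeff (X : ℤ[X]) a s t).coeff 0 = D.edgeCoeff 0 a s t := by
  rw [edgeCoeff_eq_surgeryCoeff, edgeCoeff_eq_surgeryCoeff, surgeryCoeff, surgeryCoeff]
  split_ifs
  · exact AGen.coeff_zero_mulCoeff _ _ _
  · exact AGen.coeff_zero_comulCoeff _ _ _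
  · simp

/-- The parameter $c$ occurs only in $\Delta(\mathbf 1)$, and there linearly; this is why $d$ has
only the two components $\partial$ and $\widetilde\partial$. -/
theorem natDegree_entry_le (s t : D.State) : (D.entry (X : ℤ[X]) s t).natDegree ≤ 1 := by
  refine natDegree_neg_one_pow_mul_le (natDegree_sum_le_of_forall_le _ _ fun a _ => ?_) _
  rw [signedEdgeCoeff]
  split_ifs
  · exact natDegree_neg_one_pow_mul_le (natDegree_edgeCoeff_le a s t) _
  · simp

theorem coeff_zero_entry (s t : D.State) : (D.entry (X : ℤ[X]) s t).coeff 0 = D.entry 0 s t := by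
  rw [coeff_zero_eq_eval_zero, entry, entry, eval_mul, eval_finsetSum, eval_pow, eval_neg,
    eval_one]
  congr 1
  refine Finset.sum_congr rfl fun a _ => ?_
  rw [signedEdgeCoeff, signedEdgeCoeff]
  split_ifs
  · rw [eval_mul, ← coeff_zero_eq_eval_zero (p := edgeCoeff _ _ _ _ _), coeff_zero_edgeCoeff,
      edgeSign, edgeSign, eval_pow, eval_neg, eval_one]
  · exact eval_zero

theorem exists_edgeCoeff_of_entry {s t : D.State} {k : ℕ}
    (h : (D.entry (X : ℤ[X]) s t).coeff k ≠ 0) :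
    ∃ a, a ∉ s.1 ∧ t.1 = insert a s.1 ∧ (D.edgeCoeff (X : ℤ[X]) a s t).coeff k ≠ 0 := by
  have hsign : ∀ (n : ℕ) (p : ℤ[X]), ((-1) ^ n * p).coeff k ≠ 0 → p.coeff k ≠ 0 := by
    intro n p hp
    rcases neg_one_pow_eq_or ℤ[X] n with e | e <;> simpa [e] using hp
  have h1 := hsign _ _ h
  rw [finsetSum_coeff] at h1
  obtain ⟨a, -, ha⟩ := Finset.exists_ne_zero_of_sum_ne_zero h1
  rw [signedEdgeCoeff] at ha
  split_ifs at ha with hc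
  · exact ⟨a, hc.1, hc.2, hsign _ _ ha⟩
  · exact absurd rfl ha

theorem degrees_of_entry {s t : D.State} {k : ℕ} (h : (D.entry (X : ℤ[X]) s t).coeff k ≠ 0) :
    D.hdeg t = D.hdeg s + 1 ∧ D.qdeg t + 2 * (k : ℤ) = D.qdeg s := by
  obtain ⟨a, ha, hL, he⟩ := exists_edgeCoeff_of_entry h
  rw [edgeCoeff_eq_surgeryCoeff] at he
  have h1 := (isSurgery ha hL).sum_deg (D.circle_surjective _) (D.circle_surjective _) he
  have h2 : t.1.card = s.1.card + 1 := by rw [hL, Finset.card_insert_of_notMem ha]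
  rw [hdeg, hdeg, qdeg, qdeg, h2]
  push_cast
  constructor <;> lia

theorem d_mem_C {i j : ℤ} {f : D.State → ℤ[X]} (hf : f ∈ D.C i j) : D.d f ∈ D.C (i + 1) j := by
  intro t k hk
  rw [d_apply, finsetSum_coeff] at hk
  obtain ⟨s, -, hs⟩ := Finset.exists_ne_zero_of_sum_ne_zero hk
  rw [coeff_mul] at hs
  obtain ⟨⟨m, l⟩, hml, hne⟩ := Finset.exists_ne_zero_of_sum_ne_zero hs
  rw [Finset.HasAntidiagonal.mem_antidiagonal] at hml
  have h1 := degrees_of_entry (left_ne_zero_of_mul hne)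
  have h2 := hf s l (right_ne_zero_of_mul hne)
  dsimp only at *
  subst hml
  push_cast
  constructor <;> lia

variable (D) in
/-- The part of the differential of `C(D)` that is linear in `c`. -/
noncomputable def delTilde : (D.State → ℤ) →+ (D.State → ℤ) :=
  (Matrix.mulVecLin (Matrix.of fun t s => (D.entry (X : ℤ[X]) s t).coeff 1)).toAddMonoidHom

theorem delTilde_apply (f : D.State → ℤ) (t : D.State) :
    D.delTilde f t = ∑ s, (D.entry (X : ℤ[X]) s t).coeff 1 * f s := rfl

theorem cCoeff_apply (k : ℕ) (f : D.State → ℤ[X]) (s : D.State) :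
    D.cCoeff k f s = (f s).coeff k := rfl

theorem cCoeff_zero_d (f : D.State → ℤ[X]) : D.cCoeff 0 (D.d f) = D.del (D.cCoeff 0 f) := by
  ext t
  simp only [cCoeff_apply, d_apply, del_apply, finsetSum_coeff, mul_coeff_zero, coeff_zero_entry]

theorem cCoeff_succ_d (f : D.State → ℤ[X]) (k : ℕ) :
    D.cCoeff (k + 1) (D.d f) = D.del (D.cCoeff (k + 1) f) + D.delTilde (D.cCoeff k f) := by
  ext t
  rw [Pi.add_apply, cCoeff_apply, d_apply, del_apply, delTilde_apply, finsetSum_coeff,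
    ← Finset.sum_add_distrib]
  refine Finset.sum_congr rfl fun s _ => ?_
  rw [cCoeff_apply, cCoeff_apply, ← coeff_zero_entry]
  conv_lhs => rw [eq_X_add_C_of_natDegree_le_one (natDegree_entry_le s t)]
  rw [add_mul, coeff_add, mul_assoc, coeff_C_mul, coeff_C_mul, coeff_X_mul, add_comm]

variable (D) in
/-- Multiplication by `c^k`, from `𝒞(D)` to `C(D)`. -/
noncomputable def cMonomial (k : ℕ) : (D.State → ℤ) →+ (D.State → ℤ[X]) where
  toFun g s := monomial k (g s)
  map_zero' := by ext1; simp
  map_add' f g := by ext1; simp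

theorem cCoeff_cMonomial (k l : ℕ) (g : D.State → ℤ) :
    D.cCoeff l (D.cMonomial k g) = if k = l then g else 0 := by
  ext s
  change (monomial k (g s)).coeff l = _
  rw [coeff_monomial]
  split_ifs <;> rfl

theorem cCoeff_cMonomial_self (k : ℕ) (g : D.State → ℤ) : D.cCoeff k (D.cMonomial k g) = g := by
  rw [cCoeff_cMonomial, if_pos rfl]

theorem cCoeff_ext {f g : D.State → ℤ[X]} (h : ∀ k, D.cCoeff k f = D.cCoeff k g) : f = g := by
  ext s k
  exact congrFun (h k) s

theorem mem_C_iff {i j : ℤ} {f : D.State → ℤ[X]} :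
    f ∈ D.C i j ↔ ∀ k : ℕ, D.cCoeff k f ∈ D.C0 i (j - 2 * (k : ℤ)) := by
  refine forall_comm.trans (forall_congr' fun k => forall_congr' fun s => ?_)
  refine imp_congr_right fun _ => and_congr_right fun _ => ?_
  constructor <;> intro <;> lia

theorem cMonomial_mem_C {i j : ℤ} {k : ℕ} {g : D.State → ℤ} (hg : g ∈ D.C0 i (j - 2 * (k : ℤ))) :
    D.cMonomial k g ∈ D.C i j := by
  rw [mem_C_iff]
  intro l
  rw [cCoeff_cMonomial]
  split_ifs with h
  · rwa [← h]
  · exact zero_mem _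

theorem d_d (f : D.State → ℤ[X]) : D.d (D.d f) = 0 := diff_diff _ f

theorem del_del (f : D.State → ℤ) : D.del (D.del f) = 0 := diff_diff _ f

theorem cCoeff_succ_d_cMonomial_zero (g : D.State → ℤ) :
    D.cCoeff 1 (D.d (D.cMonomial 0 g)) = D.delTilde g := by
  rw [cCoeff_succ_d, cCoeff_cMonomial_self, cCoeff_cMonomial, if_neg (by lia), map_zero, zero_add]

theorem del_mem_C0 {i j : ℤ} {f : D.State → ℤ} (hf : f ∈ D.C0 i j) : D.del f ∈ D.C0 (i + 1) j := by
  have h := mem_C_iff.1 (d_mem_C (cMonomial_mem_C (D := D) (j := j) (k := 0) (by simpa using hf))) 0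
  rw [cCoeff_zero_d, cCoeff_cMonomial_self] at h
  simpa using h

theorem delTilde_mem_C0 {i j : ℤ} {f : D.State → ℤ} (hf : f ∈ D.C0 i j) :
    D.delTilde f ∈ D.C0 (i + 1) (j - 2) := by
  have h := mem_C_iff.1 (d_mem_C (cMonomial_mem_C (D := D) (j := j) (k := 0) (by simpa using hf))) 1
  rw [cCoeff_succ_d_cMonomial_zero] at h
  simpa using h

/-- The coefficient of $c$ in $d^2=0$, evaluated on an element constant in $c$; the coefficient of
$c^2$ similarly gives `delTilde_delTilde`. -/
theorem del_delTilde_add (f : D.State → ℤ) : D.del (D.delTilde f) + D.delTilde (D.del f) = 0 := by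
  have h := congrArg (D.cCoeff 1) (d_d (D.cMonomial 0 f))
  rwa [cCoeff_succ_d, cCoeff_succ_d_cMonomial_zero, cCoeff_zero_d, cCoeff_cMonomial_self,
    map_zero] at h

theorem delTilde_delTilde (f : D.State → ℤ) : D.delTilde (D.delTilde f) = 0 := by
  have h := congrArg (D.cCoeff 2) (d_d (D.cMonomial 0 f))
  have h2 : D.cCoeff 2 (D.d (D.cMonomial 0 f)) = 0 := by
    rw [cCoeff_succ_d, cCoeff_cMonomial, cCoeff_cMonomial, if_neg (by lia), if_neg (by lia),
      map_zero, map_zero, add_zero]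
  rwa [cCoeff_succ_d, h2, cCoeff_succ_d_cMonomial_zero, map_zero, map_zero, zero_add] at h

theorem exists_coeff_eq_zero (f : D.State → ℤ[X]) : ∃ n, ∀ k, n ≤ k → D.cCoeff k f = 0 := by
  refine ⟨(Finset.univ.sup fun s => (f s).natDegree) + 1, fun k hk => ?_⟩
  ext s
  refine coeff_eq_zero_of_natDegree_lt ?_
  have := Finset.le_sup (f := fun s => (f s).natDegree) (Finset.mem_univ s)
  lia

variable (D) in
/-- The map `(g_k) ↦ ∑ c^k g_k`. -/
noncomputable def ofCoeffs (i j : ℤ) :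
    DirectSum ℕ (fun k => D.C0 i (j - 2 * (k : ℤ))) →+ D.C i j :=
  DirectSum.toAddMonoid fun k =>
    ((D.cMonomial k).comp (D.C0 i (j - 2 * (k : ℤ))).subtype).codRestrict _
      fun g => cMonomial_mem_C g.2

theorem cCoeff_ofCoeffs (i j : ℤ) (g : DirectSum ℕ (fun k => D.C0 i (j - 2 * (k : ℤ)))) (k : ℕ) :
    D.cCoeff k (D.ofCoeffs i j g) = g k := by
  induction g using DirectSum.induction_on with
  | zero => simp
  | of l g =>
    rw [ofCoeffs, DirectSum.toAddMonoid_of]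
    refine (cCoeff_cMonomial l k _).trans ?_
    rcases eq_or_ne l k with rfl | h
    · simp
    · rw [if_neg h, DirectSum.of_eq_of_ne _ _ _ h.symm]
      rfl
  | add g g' h h' =>
    rw [map_add, AddSubgroup.coe_add, map_add, h, h']
    rfl

theorem ofCoeffs_bijective (i j : ℤ) : Function.Bijective (D.ofCoeffs i j) := by
  constructor
  · intro g g' h
    refine DFinsupp.ext fun k => Subtype.ext ?_
    have := congrArg (fun f : D.C i j => D.cCoeff k f) h
    simpa only [cCoeff_ofCoeffs] using this
  · intro f
    obtain ⟨n, hn⟩ := exists_coeff_eq_zero (f : D.State → ℤ[X])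
    refine ⟨DirectSum.mk (fun k : ℕ => D.C0 i (j - 2 * (k : ℤ))) (Finset.range n)
      (fun k => ⟨D.cCoeff k f, mem_C_iff.1 f.2 k⟩), Subtype.ext (cCoeff_ext fun k => ?_)⟩
    rw [cCoeff_ofCoeffs]
    by_cases hk : k < n
    · rw [DirectSum.mk_apply_of_mem (Finset.mem_range.2 hk)]
    · rw [DirectSum.mk_apply_of_notMem (by simpa using hk), hn k (by lia)]
      rfl

theorem exists_coeff_equiv (i j : ℤ) :
    ∃ Θ : D.C i j ≃+ DirectSum ℕ (fun k => D.C0 i (j - 2 * (k : ℤ))),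
      ∀ f k, (Θ f k : D.State → ℤ) = D.cCoeff k f := by
  refine ⟨(AddEquiv.ofBijective (D.ofCoeffs i j) (ofCoeffs_bijective i j)).symm, fun f k => ?_⟩
  rw [← cCoeff_ofCoeffs]
  exact congrArg (fun f : D.C i j => D.cCoeff k f)
    ((AddEquiv.ofBijective (D.ofCoeffs i j) (ofCoeffs_bijective i j)).apply_symm_apply f)

end PlaneDiagram

end Coefficients

/-! ### The filtration by powers of $c$ and its first page. -/

section Khovanov

open CategoryTheory

namespace PlaneDiagram

variable {D : PlaneDiagram} {j : ℤ}

theorem mem_F_iff {p i : ℤ} {f : D.State → Polynomial ℤ} :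
    f ∈ D.F j p i ↔ f ∈ D.C i j ∧ ∀ k : ℕ, (k : ℤ) < p → D.cCoeff k f = 0 := by
  refine and_congr_right fun _ => ?_
  simp only [Polynomial.X_pow_dvd_iff, Int.lt_toNat, funext_iff]
  exact ⟨fun h k hk s => h s k hk, fun h s k hk => h k hk s⟩

theorem F_eq_C {p i : ℤ} (hp : p ≤ 0) : D.F j p i = D.C i j := by
  ext f
  rw [mem_F_iff, and_iff_left]
  intro k hk
  lia

variable (D j) in
theorem isFilteredComplex : IsFilteredComplex D.d (D.F j) where
  d_d := d_d
  anti hp _ hf := mem_F_iff.2 ⟨hf.1, fun k hk => (mem_F_iff.1 hf).2 k (by lia)⟩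
  map_d {p i f} hf := by
    rw [mem_F_iff] at hf ⊢
    refine ⟨d_mem_C hf.1, fun k hk => ?_⟩
    cases k with
    | zero => rw [cCoeff_zero_d, hf.2 0 hk, map_zero]
    | succ k =>
      rw [cCoeff_succ_d, hf.2 _ hk, hf.2 k (by push_cast at hk; lia), map_zero, map_zero, add_zero]

variable (D j) in
theorem exists_F_eq_bot : ∃ N : ℤ, 1 ≤ N ∧ ∀ {p i : ℤ}, N ≤ p → D.F j p i = ⊥ := by
  -- A nonzero coefficient of $c^k$ at `s` forces `2k = j - qdeg s`, so `k` is smaller than this sum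
  -- plus one, uniformly in `s` and `i`.
  refine ⟨1 + ∑ s, |j - D.qdeg s|, ?_, fun {p i} hp => eq_bot_iff.2 fun f hf => ?_⟩
  · have : 0 ≤ ∑ s, |j - D.qdeg s| := Finset.sum_nonneg fun _ _ => abs_nonneg _
    lia
  · rw [mem_F_iff] at hf
    refine cCoeff_ext fun k => ?_
    rw [map_zero]
    by_cases hk : (k : ℤ) < p
    · exact hf.2 k hk
    · ext s
      by_contra hne
      have h1 := (hf.1 s k hne).2
      have h2 := Finset.single_le_sum (f := fun s => |j - D.qdeg s|) (fun _ _ => abs_nonneg _)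
        (Finset.mem_univ s)
      have h3 := le_abs_self (j - D.qdeg s)
      lia

theorem cMonomial_mem_F {i : ℤ} {k : ℕ} {g : D.State → ℤ} (hg : g ∈ D.C0 i (j - 2 * (k : ℤ))) :
    D.cMonomial k g ∈ D.F j k i := by
  refine mem_F_iff.2 ⟨cMonomial_mem_C hg, fun l hl => ?_⟩
  rw [cCoeff_cMonomial, if_neg (by lia)]

theorem mem_F_succ_iff {i : ℤ} {k : ℕ} {f : D.State → Polynomial ℤ} :
    f ∈ D.F j (k + 1) i ↔ f ∈ D.F j k i ∧ D.cCoeff k f = 0 := by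
  rw [mem_F_iff, mem_F_iff, and_assoc]
  refine and_congr_right fun _ => ⟨fun h => ⟨fun l hl => h l (by lia), h k (by lia)⟩, ?_⟩
  rintro ⟨h, hk⟩ l hl
  rcases eq_or_ne l k with rfl | hlk
  · exact hk
  · exact h l (by lia)

theorem cCoeff_d_of_mem_F {i : ℤ} {k : ℕ} {f : D.State → Polynomial ℤ} (hf : f ∈ D.F j k i) :
    D.cCoeff k (D.d f) = D.del (D.cCoeff k f) := by
  cases k with
  | zero => exact cCoeff_zero_d f
  | succ k => rw [cCoeff_succ_d, (mem_F_iff.1 hf).2 k (by lia), map_zero, add_zero]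

theorem cCoeff_mem_cocycles {i : ℤ} {k : ℕ} {u : D.State → Polynomial ℤ}
    (hu : u ∈ filtZ D.d (D.F j) 1 k i) :
    D.cCoeff k u ∈ cocycles D.del (fun i => D.C0 i (j - 2 * (k : ℤ))) i := by
  obtain ⟨h1, h2⟩ := mem_filtZ.1 hu
  refine mem_cocycles.2 ⟨mem_C_iff.1 h1.1 k, ?_⟩
  rw [← cCoeff_d_of_mem_F h1]
  exact (mem_F_succ_iff.1 h2).2

/-- Modulo $F^{k+1}$ only the coefficient of $c^k$ survives, and on $F^k$ the differential acts on
it as $\partial$. Conversely a primitive `w` of that coefficient lifts to $c^k w$, and subtracting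
$d(c^k w)$ moves `u` into $F^{k+1}$. -/
theorem mem_filtB_one_iff {i : ℤ} {k : ℕ} {u : D.State → Polynomial ℤ}
    (hu : u ∈ filtZ D.d (D.F j) 1 k i) :
    u ∈ filtB D.d (D.F j) 1 k i ↔ ∃ w ∈ D.C0 (i - 1) (j - 2 * (k : ℤ)), D.del w = D.cCoeff k u := by
  have h := isFilteredComplex D j
  constructor
  · intro hB
    obtain ⟨v, hv, w, hw, rfl⟩ := mem_filtB.1 hB
    rw [sub_add_cancel] at hw
    refine ⟨D.cCoeff k w, mem_C_iff.1 hw.1.1 k, ?_⟩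
    rw [map_add, (mem_F_succ_iff.1 hv.1).2, zero_add, cCoeff_d_of_mem_F hw.1]
  · rintro ⟨w, hw, e⟩
    have hw' := cMonomial_mem_F hw
    have hdw := h.map_d hw'
    rw [sub_add_cancel] at hdw
    have hv : u - D.d (D.cMonomial k w) ∈ D.F j (k + 1) i := by
      refine mem_F_succ_iff.2 ⟨sub_mem hu.1 hdw, ?_⟩
      rw [map_sub, cCoeff_d_of_mem_F hw', cCoeff_cMonomial_self, e, sub_self]
    refine mem_filtB.2 ⟨_, mem_filtZ.2 ⟨hv, ?_⟩, D.cMonomial k w, mem_filtZ.2 ⟨?_, ?_⟩,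
      sub_add_cancel _ _⟩
    · rw [sub_self, add_zero]
      exact h.map_d hv
    · rwa [sub_add_cancel]
    · rw [sub_add_cancel, sub_self, add_zero, sub_add_cancel]
      exact hdw

theorem exists_page_one_equiv (k : ℕ) (q : ℤ) :
    ∃ φ : ((isFilteredComplex D j).page 1).X ((k : ℤ), q) ≃+ D.H0 (k + q) (j - 2 * k),
      ∀ u : filtZ D.d (D.F j) 1 k (k + q),
        ∃ h : D.cCoeff k u ∈ cocycles D.del (fun i => D.C0 i (j - 2 * k)) (k + q),
          φ ((isFilteredComplex D j).pageMk 1 ((k : ℤ), q) u) =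
            QuotientAddGroup.mk ⟨D.cCoeff k u, h⟩ := by
  let β : filtZ D.d (D.F j) 1 k (k + q) →+ D.H0 (k + q) (j - 2 * k) :=
    (QuotientAddGroup.mk' _).comp
      (((D.cCoeff k).comp (filtZ D.d (D.F j) 1 k (k + q)).subtype).codRestrict
        (cocycles D.del (fun i => D.C0 i (j - 2 * k)) (k + q)) fun u => cCoeff_mem_cocycles u.2)
  -- A cocycle `g` lifts to $c^k g$, whose differential has $c^k$-coefficient $\partial g=0$.
  have hβ : Function.Surjective β := by
    intro x
    obtain ⟨⟨g, hg⟩, rfl⟩ := QuotientAddGroup.mk_surjective x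
    obtain ⟨hg1, hg2⟩ := mem_cocycles.1 hg
    have hF := cMonomial_mem_F hg1
    refine ⟨⟨D.cMonomial k g, mem_filtZ.2 ⟨hF, mem_F_succ_iff.2
      ⟨(isFilteredComplex D j).map_d hF, ?_⟩⟩⟩, ?_⟩
    · rw [cCoeff_d_of_mem_F hF, cCoeff_cMonomial_self, hg2]
    · exact congrArg QuotientAddGroup.mk (Subtype.ext (cCoeff_cMonomial_self k g))
  have hαβ : ∀ u, (isFilteredComplex D j).pageMk 1 ((k : ℤ), q) u = 0 ↔ β u = 0 := by
    intro u
    refine ((isFilteredComplex D j).pageMk_eq_zero_iff u).trans ((mem_filtB_one_iff u.2).trans ?_)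
    exact (Cohomology.mk_eq_zero_iff (d := D.del) (K := fun i => D.C0 i (j - 2 * (k : ℤ)))
      ⟨D.cCoeff k u, cCoeff_mem_cocycles u.2⟩).symm
  obtain ⟨φ, hφ⟩ := exists_addEquiv_of_surjective (C := D.H0 (k + q) (j - 2 * k))
    ((isFilteredComplex D j).pageMk 1 ((k : ℤ), q)) β
    ((isFilteredComplex D j).pageMk_surjective 1 ((k : ℤ), q)) hβ hαβ
  exact ⟨φ, fun u => ⟨cCoeff_mem_cocycles u.2, hφ u⟩⟩

end PlaneDiagram

end Khovanov

open CategoryTheory in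
theorem mainTheorem11 (D : PlaneDiagram) :
    -- `C(D)` and `𝒞(D)` are complexes of graded groups
    (∀ f, D.d (D.d f) = 0) ∧ (∀ f, D.del (D.del f) = 0) ∧
    (∀ i j, ∀ f ∈ D.C i j, D.d f ∈ D.C (i + 1) j) ∧
    (∀ i j, ∀ f ∈ D.C0 i j, D.del f ∈ D.C0 (i + 1) j) ∧
    -- `C^i_j(D) = ⨁_{k ≥ 0} c^k 𝒞^i_{j-2k}(D)`
    (∀ i j : ℤ, ∃ Θ : D.C i j ≃+ DirectSum ℕ (fun k => D.C0 i (j - 2 * (k : ℤ))),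
      ∀ f k, (Θ f k : D.State → ℤ) = D.cCoeff k f) ∧
    -- `d = ∂ + ∂'`, where `∂'` has bidegree `(1, -1)`
    (∃ del' : (D.State → ℤ) →+ (D.State → ℤ),
      (∀ i j, ∀ f ∈ D.C0 i j, del' f ∈ D.C0 (i + 1) (j - 2)) ∧
      (∀ f, D.cCoeff 0 (D.d f) = D.del (D.cCoeff 0 f)) ∧
      (∀ f k, D.cCoeff (k + 1) (D.d f) = D.del (D.cCoeff (k + 1) f) + del' (D.cCoeff k f)) ∧
      (∀ f, del' (del' f) = 0) ∧
      (∀ f, D.del (del' f) + del' (D.del f) = 0)) ∧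
    -- the spectral sequence of the filtration by powers of `c`
    ∀ j : ℤ, ∃ (E : CohomologicalSpectralSequence AddCommGrpCat.{0} 1)
      (π : ∀ (r : ℤ) (hr : 1 ≤ r) (p q : ℤ),
        filtZ D.d (D.F j) r p (p + q) →+ (E.page r hr).X (p, q)),
      IsFiltrationSpectralSequence D.d (D.F j) E π ∧
      -- its first page
      (∀ p q : ℤ, p < 0 → Subsingleton ((E.page 1 le_rfl).X (p, q))) ∧
      (∀ (k : ℕ) (q : ℤ),
        ∃ φ : (E.page 1 le_rfl).X ((k : ℤ), q) ≃+ D.H0 (k + q) (j - 2 * k),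
          ∀ u : filtZ D.d (D.F j) 1 k (k + q),
            ∃ h : D.cCoeff k u ∈ cocycles D.del (fun i => D.C0 i (j - 2 * k)) (k + q),
            φ (π 1 le_rfl k q u) = QuotientAddGroup.mk ⟨D.cCoeff k u, h⟩) ∧
      -- its convergence to `H^{i,j}(D)`
      (∀ i p : ℤ, p ≤ 0 → filtCohomology D.d (fun i => D.C i j) (D.F j) p i = ⊤) ∧
      ∃ N : ℤ, 1 ≤ N ∧
        (∀ i p : ℤ, N ≤ p → filtCohomology D.d (fun i => D.C i j) (D.F j) p i = ⊥) ∧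
        ∀ (r : ℤ) (hr : 1 ≤ r), N ≤ r → ∀ p q : ℤ,
          (∀ p' q' : ℤ, (E.page r hr).d (p, q) (p', q') = 0) ∧
          ∃ ψ : (E.page r hr).X (p, q) ≃+
              filtCohomology D.d (fun i => D.C i j) (D.F j) p (p + q) ⧸
                (filtCohomology D.d (fun i => D.C i j) (D.F j) (p + 1) (p + q)).addSubgroupOf
                  (filtCohomology D.d (fun i => D.C i j) (D.F j) p (p + q)),
            ∀ (v : cocycles D.d (fun i => D.C i j) (p + q)) (hv : (v : D.State → _) ∈ D.F j p (p + q)),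
              ∃ h : (v : D.State → _) ∈ filtZ D.d (D.F j) r p (p + q),
                ψ (π r hr p q ⟨v, h⟩) =
                  QuotientAddGroup.mk ⟨QuotientAddGroup.mk v, ⟨v, hv, rfl⟩⟩ := by

  refine ⟨PlaneDiagram.d_d, PlaneDiagram.del_del, fun i j f => PlaneDiagram.d_mem_C,
    fun i j f => PlaneDiagram.del_mem_C0, PlaneDiagram.exists_coeff_equiv,
    ⟨D.delTilde, fun i j f => PlaneDiagram.delTilde_mem_C0, PlaneDiagram.cCoeff_zero_d,
      PlaneDiagram.cCoeff_succ_d, PlaneDiagram.delTilde_delTilde, PlaneDiagram.del_delTilde_add⟩,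
    fun j => ?_⟩
  have h := PlaneDiagram.isFilteredComplex D j
  have hK : ∀ {p i : ℤ}, p ≤ 0 → D.F j p i = D.C i j := PlaneDiagram.F_eq_C
  obtain ⟨N, hN1, hN⟩ := PlaneDiagram.exists_F_eq_bot D j
  refine ⟨h.spectralSequence, fun r _ p q => h.pageMk r (p, q), h.isFiltrationSpectralSequence,
    fun p q hp => h.subsingleton_page_of_neg (K := fun i => D.C i j) (fun e => hK e) q hp,
    PlaneDiagram.exists_page_one_equiv,
    fun i p hp => filtCohomology_eq_top (K := fun i => D.C i j) (fun e => hK e) hp, N, hN1,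
    fun i p hp => filtCohomology_eq_bot (hN hp), fun r _ hr p q =>
      ⟨fun p' q' => h.page_d_eq_zero (K := fun i => D.C i j) (fun e => hK e) hN hr _ _,
        h.exists_page_equiv_filtCohomology (K := fun i => D.C i j) (fun e => hK e) hN hr p q⟩⟩
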